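/- **Setting.** Let $f:\mathbb R^n\to\mathbb R$ be continuous and piecewise-differentiable: there are finitely many branch functions $f_\theta:\widetilde{\mathcal D}_\theta\to\mathbb R$, $\theta\in\Theta$, each $C^1$ on an open set $\widetilde{\mathcal D}_\theta$, such that, with $\widetilde{\mathcal M}(x)=\{\theta: x\in\widetilde{\mathcal D}_\theta\}$ (feasible branches) and $\mathcal M(x)=\{\theta\in\widetilde{\mathcal M}(x): f_\theta(x)=f(x)\}$ (active branches): (i) $\mathcal M(x)\ne\emptyset$ for every $x$; (ii) for every $x$, $\theta\in\mathcal M(x)$ and $\epsilon>0$ there is a nonempty open $C\subseteq\widetilde{\mathcal D}_\theta$ with $\overline C\subseteq\mathbb B(x,\epsilon)$, $f=f_\theta$ on $C$, and $f(y)\neq f_{\theta'}(y)$ for all $\theta'\ne\theta$ and $y\in C\cap\widetilde{\mathcal D}_{\theta'}$; (iii) every $x$ has a neighbourhood on which $\mathcal M(y)\subseteq\mathcal M(x)$; (iv) if $f$ is differentiable at $x$, then $\nabla f(x)=\nabla f_\theta(x)$ for all $\theta\in\mathcal M(x)$. Algorithms may access $\mathcal M(x)$, may test $\theta\in\widetilde{\mathcal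 M}(x)$, and may evaluate $f_\theta(x)$ and $\nabla f_\theta(x)$ for $\theta\in\widetilde{\mathcal M}(x)$ (encodability). Assume that the gradients $\nabla f_\theta$ are Lipschitz on $\widetilde{\mathcal D}_\theta$ with a common constant $L_\Theta$ and that every $f_\theta$ is twice differentiable on $\widetilde{\mathcal D}_\theta$. For nonempty $\mathcal C\subseteq\Theta$, the joint gradient $\mathrm{vec}(x,\mathcal C)$ is the minimum-norm element of $\mathrm{conv}\{\nabla f_\theta(x):\theta\in\mathcal C\}$. Let $x^*$ be a local minimizer of $f$. A nonempty set $\mathcal C\subseteq\mathcal M(x^*)$ is a *complete basis* at $x^*$ if $\mathrm{vec}(x^*,\mathcal C)=0$ and either $|\mathcal C|=1$ or $\mathrm{vec}(x^*,\mathcal C')\ne0$ for every nonempty $\mathcal C'\subsetneq\mathcal C$. Assume: * *(local max-representability)* $f(x)=\max\{f_\theta(x):\theta\in\widetilde{\mathcal M}(x)\}$ for all $x$ in an open neighbourhood of $x^*$; * *(complementary positive-definiteness)* for every $\mathcal C\subseteq\mathcal M(x^*)$ containing a complete basis, every $\theta\in\mathcal C$ and every nonzero $v\perp\mathrm{span}\{\nabla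 f_i(x^*):i\in\mathcal C\}$, one has $v^\top\nabla^2f_\theta(x^*)v>0$; * *(dimension consistency)* some complete basis $\mathcal C$ at $x^*$ satisfies $\mathrm{span}\{\nabla f_\theta(x^*):\theta\in\mathcal C\}=\mathrm{span}\{\nabla f_\theta(x^*):\theta\in\mathcal M(x^*)\}$. **Algorithm (EBIGD)** with parameters $\rho_0,\gamma\in(0,1)$ and step size $\alpha>0$. One iteration at $x=x_k$: 1. *BranchSelection.* Start with $\mathcal C=\{\theta\}$ for an arbitrary $\theta\in\mathcal M(x)$. Repeat: compute $d=\mathrm{vec}(x,\mathcal C)$; if $d=0$ or $[f(x)-f(x-\alpha d)]/(\alpha\|d\|^2)\ge\rho_0$, return $(\mathcal C,d)$; otherwise take an arbitrary $\theta\in\mathcal M(x-\alpha d)$ and add it to $\mathcal C$ if $\theta\in\widetilde{\mathcal M}(x)$ (leave $\mathcal C$ unchanged if not). 2. *JointGradientReduction.* If $d\neq0$, set $y=x-\alpha d$ and $r=f(x)-f(x-\alpha d)$; else $y=x$, $r=0$. 3. *GapReduction.* Starting from the set $\mathcal C$ of step 1, let $(z,s)\in\mathbb R\times\mathbb R^n$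 minimize $\sum_{i\in\mathcal C}(z+\langle\nabla f_i(x),s\rangle-f_i(x))^2+\|s\|^4$; while $\mathcal M(x-\gamma s)\cap\mathcal C=\emptyset$, add an arbitrary $\theta\in\mathcal M(x-\gamma s)$ to $\mathcal C$ and solve again. Then, if $f(x)-f(x-\gamma s)\ge0$, set $y'=x-\gamma s$ and $r'=f(x)-f(x-\gamma s)$; else $y'=x$, $r'=0$. 4. Set $x_{k+1}=y$ if $r\ge r'$, and $x_{k+1}=y'$ otherwise. **Theorem (local linear convergence).** Under these assumptions, for all $\rho_0,\gamma\in(0,1)$ there are $\alpha_0>0$ and a neighbourhood $U$ of $x^*$ such that for every $\alpha\in(0,\alpha_0)$ there are $q\in(0,1)$ and $K$ with the following property. From every $x_0\in U$ and for all arbitrary choices, every iteration of EBIGD is well defined (both inner loops terminate, only branches feasible at $x_k$ are evaluated at $x_k$, and a next iterate exists), and for every $k\ge0$ $$f(x_k)\ge f(x^*),\qquad f(x_{k+1})-f(x^*)\le q\,\bigl(f(x_k)-f(x^*)\bigr),\qquad \|x_k-x^*\|\le K q^k .$$ -/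

import Mathlib

open Set Filter Topology

/-- The data of a function `f : ℝⁿ → ℝ` given by branches: `branch θ` is meaningful on `dom θ` only
(its values elsewhere are irrelevant). -/
structure BranchedFunction (n : ℕ) (Θ : Type*) where
  f : EuclideanSpace ℝ (Fin n) → ℝ
  dom : Θ → Set (EuclideanSpace ℝ (Fin n))
  branch : Θ → EuclideanSpace ℝ (Fin n) → ℝ

namespace BranchedFunction

variable {n : ℕ} {Θ : Type*}

/-- The feasible branches at `x`. -/
def feasible (P : BranchedFunction n Θ) (x : EuclideanSpace ℝ (Fin n)) : Set Θ :=
  {θ | x ∈ P.dom θ}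

/-- The active branches `𝓜(x)`. -/
def active (P : BranchedFunction n Θ) (x : EuclideanSpace ℝ (Fin n)) : Set Θ :=
  {θ | x ∈ P.dom θ ∧ P.branch θ x = P.f x}

/-- `f` is piecewise-differentiable with the given branches. -/
structure IsPiecewiseDifferentiable (P : BranchedFunction n Θ) : Prop where
  continuous : Continuous P.f
  isOpen_dom : ∀ θ, IsOpen (P.dom θ)
  contDiffOn : ∀ θ, ContDiffOn ℝ 1 (P.branch θ) (P.dom θ)
  exists_active : ∀ x, (P.active x).Nonempty
  characteristic_region : ∀ x, ∀ θ ∈ P.active x, ∀ ε > 0,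
    ∃ C : Set (EuclideanSpace ℝ (Fin n)), IsOpen C ∧ C.Nonempty ∧ C ⊆ P.dom θ ∧
      closure C ⊆ Metric.ball x ε ∧
      (∀ y ∈ C, P.f y = P.branch θ y) ∧
      ∀ θ', θ' ≠ θ → ∀ y ∈ C ∩ P.dom θ', P.f y ≠ P.branch θ' y
  active_subset : ∀ x, ∀ᶠ y in 𝓝 x, P.active y ⊆ P.active x
  gradient_eq : ∀ x, DifferentiableAt ℝ P.f x →
    ∀ θ ∈ P.active x, gradient P.f x = gradient (P.branch θ) x

/-- The Hessian of the branch `θ` at `x`, as the derivative of its gradient. -/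
noncomputable def hessian (P : BranchedFunction n Θ) (θ : Θ) (x : EuclideanSpace ℝ (Fin n)) :
    EuclideanSpace ℝ (Fin n) →L[ℝ] EuclideanSpace ℝ (Fin n) :=
  fderiv ℝ (gradient (P.branch θ)) x

/-- Every branch function is twice differentiable on its domain. -/
def TwiceDifferentiable (P : BranchedFunction n Θ) : Prop :=
  ∀ θ, ∀ x ∈ P.dom θ, DifferentiableAt ℝ (gradient (P.branch θ)) x

/-- In some open neighbourhood of `p`, `f` is the maximum of its feasible branch functions. -/
def LocallyMaxRepresentable (P : BranchedFunction n Θ) (p : EuclideanSpace ℝ (Fin n)) : Prop :=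
  ∃ A : Set (EuclideanSpace ℝ (Fin n)), IsOpen A ∧ p ∈ A ∧
    ∀ x ∈ A, IsGreatest ((fun θ => P.branch θ x) '' P.feasible x) (P.f x)

/-- Feasible weights of the quadratic program over `C`. -/
def IsWeight (C : Finset Θ) (w : Θ → ℝ) : Prop :=
  ∑ θ ∈ C, w θ = 1 ∧ ∀ θ ∈ C, 0 ≤ w θ

/-- `d` is the joint gradient at `x` of the branches in `C`: the optimal vector of
`min ‖∑ θ ∈ C, w θ • ∇f_θ(x)‖²` over all feasible weights. -/
def IsJointGradient (P : BranchedFunction n Θ) (x : EuclideanSpace ℝ (Fin n)) (C : Finset Θ)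
    (d : EuclideanSpace ℝ (Fin n)) : Prop :=
  ∃ w : Θ → ℝ, IsWeight C w ∧ d = ∑ θ ∈ C, w θ • gradient (P.branch θ) x ∧
    ∀ v : Θ → ℝ, IsWeight C v → ‖d‖ ^ 2 ≤ ‖∑ θ ∈ C, v θ • gradient (P.branch θ) x‖ ^ 2

/-- Complete basis at `p`. The empty set has no joint gradient, so the last clause concerns
nonempty proper subsets. -/
def IsCompleteBasis (P : BranchedFunction n Θ) (p : EuclideanSpace ℝ (Fin n))
    (C : Finset Θ) : Prop :=
  (C : Set Θ) ⊆ P.active p ∧ (∃ d, P.IsJointGradient p C d ∧ ‖d‖ = 0) ∧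
    (C.card = 1 ∨ ∀ C' : Finset Θ, C' ⊂ C → ∀ d, P.IsJointGradient p C' d → 0 < ‖d‖)

/-- The span of the gradients at `p` of the branches in a set `S`. -/
def gradSpan (P : BranchedFunction n Θ) (p : EuclideanSpace ℝ (Fin n)) (S : Set Θ) :
    Submodule ℝ (EuclideanSpace ℝ (Fin n)) :=
  Submodule.span ℝ ((fun θ => gradient (P.branch θ) p) '' S)

/-- The complementary positive-definite condition at `p`. -/
def ComplementaryPosDef (P : BranchedFunction n Θ) (p : EuclideanSpace ℝ (Fin n)) : Prop :=
  ∀ C : Finset Θ, (C : Set Θ) ⊆ P.active p → (∃ B ⊆ C, P.IsCompleteBasis p B) →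
    ∀ θ ∈ C, ∀ v ∈ (P.gradSpan p C)ᗮ, v ≠ 0 → 0 < inner ℝ v (P.hessian θ p v)

/-- The dimension consistency condition at `p`. -/
def DimensionConsistent (P : BranchedFunction n Θ) (p : EuclideanSpace ℝ (Fin n)) : Prop :=
  ∃ C : Finset Θ, P.IsCompleteBasis p C ∧ P.gradSpan p C = P.gradSpan p (P.active p)

/-! The algorithm. Choices of active branches are arbitrary, so every routine is a relation
between its input and its possible outputs. -/

/-- `x - α d` decreases `f` sufficiently: `(f(x) - f(x - α d)) / (α ‖d‖²) ≥ ρ₀`. -/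
def SufficientDecrease (P : BranchedFunction n Θ) (ρ₀ α : ℝ) (x d : EuclideanSpace ℝ (Fin n)) :
    Prop :=
  ρ₀ ≤ (P.f x - P.f (x - α • d)) / (α * ‖d‖ ^ 2)

/-- One pass of the loop of `BranchSelection` that does not end the loop, turning the current set
`C` into `C'`. -/
def SelectionStep [DecidableEq Θ] (P : BranchedFunction n Θ) (ρ₀ α : ℝ)
    (x : EuclideanSpace ℝ (Fin n)) (C C' : Finset Θ) : Prop :=
  ∃ d, P.IsJointGradient x C d ∧ ‖d‖ ≠ 0 ∧ ¬ P.SufficientDecrease ρ₀ α x d ∧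
    ∃ θ ∈ P.active (x - α • d),
      (θ ∈ P.feasible x ∧ C' = insert θ C) ∨ (θ ∉ P.feasible x ∧ C' = C)

/-- `BranchSelection` at `x` can return `[C, d]`. -/
def SelectionReturns [DecidableEq Θ] (P : BranchedFunction n Θ) (ρ₀ α : ℝ)
    (x : EuclideanSpace ℝ (Fin n)) (C : Finset Θ) (d : EuclideanSpace ℝ (Fin n)) : Prop :=
  (∃ θ ∈ P.active x, Relation.ReflTransGen (P.SelectionStep ρ₀ α x) {θ} C) ∧
    P.IsJointGradient x C d ∧ (‖d‖ = 0 ∨ P.SufficientDecrease ρ₀ α x d)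

open Classical in
/-- `JointGradientReduction`: the candidate point and its reduction. -/
noncomputable def jointGradientReduction (P : BranchedFunction n Θ) (α : ℝ)
    (x d : EuclideanSpace ℝ (Fin n)) : EuclideanSpace ℝ (Fin n) × ℝ :=
  if 0 < ‖d‖ then (x - α • d, P.f x - P.f (x - α • d)) else (x, 0)

/-- Objective of the direction-recovery program. -/
noncomputable def recoveryObjective (P : BranchedFunction n Θ) (x : EuclideanSpace ℝ (Fin n))
    (C : Finset Θ) (z : ℝ) (s : EuclideanSpace ℝ (Fin n)) : ℝ :=
  ∑ θ ∈ C, (z + inner ℝ (gradient (P.branch θ) x) s - P.branch θ x) ^ 2 + ‖s‖ ^ 4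

/-- `(z, s)` is an optimal solution of the direction-recovery program. -/
def IsRecoverySolution (P : BranchedFunction n Θ) (x : EuclideanSpace ℝ (Fin n)) (C : Finset Θ)
    (z : ℝ) (s : EuclideanSpace ℝ (Fin n)) : Prop :=
  ∀ z' s', P.recoveryObjective x C z s ≤ P.recoveryObjective x C z' s'

/-- One return from Step 2 to Step 1 in `GapReduction`. -/
def GapStep [DecidableEq Θ] (P : BranchedFunction n Θ) (γ : ℝ) (x : EuclideanSpace ℝ (Fin n))
    (C C' : Finset Θ) : Prop :=
  ∃ z s, P.IsRecoverySolution x C z s ∧ P.active (x - γ • s) ∩ (C : Set Θ) = ∅ ∧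
    ∃ θ ∈ P.active (x - γ • s), C' = insert θ C

open Classical in
/-- Step 3 of `GapReduction`: the candidate point and its reduction. -/
noncomputable def gapCandidate (P : BranchedFunction n Θ) (γ : ℝ)
    (x s : EuclideanSpace ℝ (Fin n)) : EuclideanSpace ℝ (Fin n) × ℝ :=
  if 0 ≤ P.f x - P.f (x - γ • s) then (x - γ • s, P.f x - P.f (x - γ • s)) else (x, 0)

/-- `GapReduction`, called with the set `C`, can return the pair `out` (point, reduction). -/
def GapReturns [DecidableEq Θ] (P : BranchedFunction n Θ) (γ : ℝ) (x : EuclideanSpace ℝ (Fin n))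
    (C : Finset Θ) (out : EuclideanSpace ℝ (Fin n) × ℝ) : Prop :=
  ∃ C', Relation.ReflTransGen (P.GapStep γ x) C C' ∧
    ∃ z s, P.IsRecoverySolution x C' z s ∧ (P.active (x - γ • s) ∩ (C' : Set Θ)).Nonempty ∧
      out = P.gapCandidate γ x s

/-- One outer iteration of EBIGD can lead from `x` to `x'`. -/
def EBIGDStep [DecidableEq Θ] (P : BranchedFunction n Θ) (ρ₀ α γ : ℝ)
    (x x' : EuclideanSpace ℝ (Fin n)) : Prop :=
  ∃ C d, P.SelectionReturns ρ₀ α x C d ∧ ∃ out, P.GapReturns γ x C out ∧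
    ((out.2 ≤ (P.jointGradientReduction α x d).2 ∧ x' = (P.jointGradientReduction α x d).1) ∨
      ((P.jointGradientReduction α x d).2 < out.2 ∧ x' = out.1))

/-- The loop with the given step relation cannot run forever from the given state. -/
def LoopHalts (step : Finset Θ → Finset Θ → Prop) (C : Finset Θ) : Prop :=
  ¬ ∃ s : ℕ → Finset Θ, s 0 = C ∧ ∀ i, step (s i) (s (i + 1))

/-- The outer iteration of EBIGD at `x` is well defined, whatever choices are made: both inner loops
terminate and only branches whose domain contains `x` are evaluated at `x`. -/
def EBIGDWellDefinedAt [DecidableEq Θ] (P : BranchedFunction n Θ) (ρ₀ α γ : ℝ)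
    (x : EuclideanSpace ℝ (Fin n)) : Prop :=
  (∀ θ ∈ P.active x, LoopHalts (P.SelectionStep ρ₀ α x) {θ}) ∧
    ∀ C d, P.SelectionReturns ρ₀ α x C d → LoopHalts (P.GapStep γ x) C ∧
      ∀ C', Relation.ReflTransGen (P.GapStep γ x) C C' → (C' : Set Θ) ⊆ P.feasible x

end BranchedFunction

/-! Let `p` be the minimizer, `V` the span of the gradients active at `p`, `e = x - p` and `F = f x
- f p`. Near `p` every active branch lies below `f`. A complete basis spanning `V` has, in each
direction of `V`, a branch of positive slope, and the Hessians are positive definite on `Vᗮ`; hence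
`F` dominates both the norm of the projection of `e` on `V` and `‖e‖ ^ 2` (`exists_growth`). Testing
a joint gradient `d` against the component of `e` in `Vᗮ` gives `μ ‖e‖ ≤ ‖d‖ + κ F`
(`exists_norm_sum_gradient_lower_bound` with the growth bound).

Let `C` be the selected set. If no convex combination of its gradients vanishes at `p`, then `‖d‖`
is bounded below and the gradient step gains a fixed amount. Otherwise the recovered direction
reduces the gap to `(1 - γ) F` up to an error `K₂ ‖e‖ ^ 2` (`f_sub_smul_le`). If that error is at
most `γ / 2 * F`, the gap step gains a fixed fraction of `F`; if not, `F` is of order `‖e‖ ^ 2`, so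
`‖d‖` is at least of order `‖e‖` and the gradient step gains a fixed fraction of `F`. The better
candidate is kept, so `F` contracts (`step_spec`), and quadratic growth turns this into convergence
of the iterates. -/

/-! ### Taylor estimates. -/

section Taylor

variable {E : Type*} [NormedAddCommGroup E] [InnerProductSpace ℝ E] [CompleteSpace E]

/-- First order Taylor estimate for a function with Lipschitz gradient. -/
theorem abs_sub_sub_inner_gradient_le {f : E → ℝ} {s : Set E} {L : NNReal}
    (hL : LipschitzOnWith L (gradient f) s) (hf : ∀ z ∈ s, DifferentiableAt ℝ f z)
    (hs : Convex ℝ s) {x y : E} (hx : x ∈ s) (hy : y ∈ s) :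
    |f y - f x - inner ℝ (gradient f x) (y - x)| ≤ L * ‖y - x‖ ^ 2 := by
  have hseg : segment ℝ x y ⊆ s := hs.segment_subset hx hy
  -- The mean value inequality for `f` minus its linearization at `x` suffices; it costs only the
  -- factor `1 / 2` of the sharp constant.
  have key := (convex_segment x y).norm_image_sub_le_of_norm_hasFDerivWithin_le' (𝕜 := ℝ)
    (f := f) (f' := fun z => InnerProductSpace.toDual ℝ E (gradient f z))
    (φ := InnerProductSpace.toDual ℝ E (gradient f x)) (C := L * ‖y - x‖)
    (fun z hz => ((hf z (hseg hz)).hasGradientAt.hasFDerivAt).hasFDerivWithinAt)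
    (fun z hz => by
      rw [← map_sub, LinearIsometryEquiv.norm_map]
      refine (hL.norm_sub_le (hseg hz) hx).trans ?_
      gcongr
      exact norm_sub_le_of_mem_segment hz)
    (left_mem_segment ℝ x y) (right_mem_segment ℝ x y)
  simpa [Real.norm_eq_abs, pow_two, mul_assoc] using key

/-- A function that is twice differentiable at `p` admits a linear expansion of its gradient. -/
theorem eventually_norm_gradient_sub_le {f : E → ℝ} {p : E}
    (h : DifferentiableAt ℝ (gradient f) p) {ε : ℝ} (hε : 0 < ε) :
    ∀ᶠ x in 𝓝 p, ‖gradient f x - gradient f p - fderiv ℝ (gradient f) p (x - p)‖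
      ≤ ε * ‖x - p‖ :=
  h.hasFDerivAt.isLittleO.def hε

/-- Second order Taylor estimate at `p`. -/
theorem eventually_abs_sub_second_order_le {f : E → ℝ} {p : E}
    (h : DifferentiableAt ℝ (gradient f) p) (hf : ∀ᶠ x in 𝓝 p, DifferentiableAt ℝ f x)
    {ε : ℝ} (hε : 0 < ε) :
    ∀ᶠ x in 𝓝 p, |f x - f p - inner ℝ (gradient f p) (x - p)
      - inner ℝ (x - p) (fderiv ℝ (gradient f) p (x - p)) / 2| ≤ ε * ‖x - p‖ ^ 2 := by
  obtain ⟨r, hr, hball⟩ := Metric.eventually_nhds_iff_ball.1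
    ((eventually_norm_gradient_sub_le h hε).and hf)
  filter_upwards [Metric.ball_mem_nhds p hr] with x hx
  set e := x - p with he
  set H := fderiv ℝ (gradient f) p with hH
  have hmem : ∀ t ∈ Icc (0 : ℝ) 1, p + t • e ∈ Metric.ball p r := by
    intro t ht
    rw [mem_ball_iff_norm] at hx ⊢
    rw [add_sub_cancel_left, norm_smul, Real.norm_of_nonneg ht.1]
    exact (mul_le_of_le_one_left (norm_nonneg _) ht.2).trans_lt hx
  -- The remainder is followed along the segment from `p` to `x`. Only the quadratic form at `e`
  -- occurs, so symmetry of the Hessian is not needed.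
  have hder : ∀ t ∈ Icc (0 : ℝ) 1, HasDerivWithinAt
      (fun t : ℝ => f (p + t • e) - t * inner ℝ (gradient f p) e - t ^ 2 * (inner ℝ e (H e) / 2))
      (inner ℝ (gradient f (p + t • e) - gradient f p - H (t • e)) e) (Icc 0 1) t := by
    intro t ht
    have h1 : HasDerivAt (fun t : ℝ => p + t • e) e t := by
      simpa using ((hasDerivAt_id t).smul_const e).const_add p
    have h2 := ((hball _ (hmem t ht)).2.hasGradientAt.hasFDerivAt).comp_hasDerivAt t h1
    have h3 := (h2.sub ((hasDerivAt_id t).mul_const (inner ℝ (gradient f p) e))).sub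
      (((hasDerivAt_id t).pow 2).mul_const (inner ℝ e (H e) / 2))
    refine (h3.congr_deriv ?_).hasDerivWithinAt
    simp only [InnerProductSpace.toDual_apply_apply, map_smul, inner_sub_left, inner_smul_left,
      real_inner_comm e (H e)]
    simp
    ring
  have key := norm_image_sub_le_of_norm_deriv_le_segment_01' hder (C := ε * ‖e‖ ^ 2) (by
    intro t ht
    have ht' : t ∈ Icc (0 : ℝ) 1 := ⟨ht.1, ht.2.le⟩
    refine (norm_inner_le_norm _ _).trans ?_
    have h1 := (hball _ (hmem t ht')).1
    rw [add_sub_cancel_left] at h1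
    have h2 : ‖t • e‖ ≤ ‖e‖ := by
      rw [norm_smul, Real.norm_of_nonneg ht.1]
      exact mul_le_of_le_one_left (norm_nonneg _) ht.2.le
    calc _ ≤ (ε * ‖e‖) * ‖e‖ := by gcongr; exact h1.trans (by gcongr)
      _ = _ := by ring)
  have hxe : p + e = x := by rw [he]; abel
  rw [Real.norm_eq_abs] at key
  simp only [one_smul, zero_smul, hxe, add_zero] at key
  convert key using 2
  ring

end Taylor

/-! ### Compactness, terminating loops and convex weights. -/

/-- A continuous positively homogeneous function that is positive on a subspace away from the
origin is bounded below there by a multiple of the power of the norm. -/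
theorem exists_pos_mul_norm_pow_le {E : Type*} [NormedAddCommGroup E] [NormedSpace ℝ E]
    [FiniteDimensional ℝ E] (V : Submodule ℝ E) {φ : E → ℝ} (hφ : Continuous φ) {k : ℕ}
    (hk : k ≠ 0) (h0 : φ 0 = 0) (hom : ∀ t : ℝ, 0 < t → ∀ u, φ (t • u) = t ^ k * φ u)
    (hpos : ∀ u ∈ V, u ≠ 0 → 0 < φ u) :
    ∃ c > 0, ∀ u ∈ V, c * ‖u‖ ^ k ≤ φ u := by
  have hcomp : IsCompact (Metric.sphere (0 : E) 1 ∩ V) :=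
    (isCompact_sphere 0 1).inter_right V.closed_of_finiteDimensional
  rcases (Metric.sphere (0 : E) 1 ∩ (V : Set E)).eq_empty_or_nonempty with hemp | hne
  · refine ⟨1, one_pos, fun u hu => ?_⟩
    by_cases hu0 : u = 0
    · simp [hu0, hk, h0]
    · exfalso
      have : ‖u‖⁻¹ • u ∈ Metric.sphere (0 : E) 1 ∩ (V : Set E) :=
        ⟨by simp [norm_smul, hu0], V.smul_mem _ hu⟩
      simp [hemp] at this
  · obtain ⟨v, hv, hmin⟩ := hcomp.exists_isMinOn hne hφ.continuousOn
    have hv0 : v ≠ 0 := by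
      rintro rfl
      simp at hv
    refine ⟨φ v, hpos v hv.2 hv0, fun u hu => ?_⟩
    by_cases hu0 : u = 0
    · simp [hu0, hk, h0]
    · have hn : 0 < ‖u‖ := norm_pos_iff.2 hu0
      have hmem : ‖u‖⁻¹ • u ∈ Metric.sphere (0 : E) 1 ∩ (V : Set E) :=
        ⟨by simp [norm_smul, hu0], V.smul_mem _ hu⟩
      have h1 : φ v ≤ φ (‖u‖⁻¹ • u) := hmin hmem
      have h2 : φ u = ‖u‖ ^ k * φ (‖u‖⁻¹ • u) := by
        rw [← hom _ hn, smul_smul, mul_inv_cancel₀ hn.ne', one_smul]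
      rw [h2, mul_comm]
      gcongr

/-- A loop that enlarges a finite set whenever a terminal state is not reached does reach one. -/
theorem Finset.exists_reflTransGen_terminal {ι : Type*} [Fintype ι]
    {step : Finset ι → Finset ι → Prop} {inv done : Finset ι → Prop}
    (hstep : ∀ C, inv C → ¬ done C → ∃ C', step C C' ∧ inv C' ∧ C ⊂ C')
    (C : Finset ι) (hC : inv C) :
    ∃ C', Relation.ReflTransGen step C C' ∧ inv C' ∧ done C' := by
  induction C using WellFoundedGT.induction with
  | ind C ih =>
    by_cases hd : done C
    · exact ⟨C, .refl, hC, hd⟩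
    · obtain ⟨C₁, h1, h2, h3⟩ := hstep C hC hd
      obtain ⟨C', h4, h5⟩ := ih C₁ h3 h2
      exact ⟨C', .head h1 h4, h5⟩

namespace BranchedFunction

/-- A loop all of whose steps enlarge the current set halts. -/
theorem loopHalts_of_ssubset {Θ : Type*} [Fintype Θ] {step : Finset Θ → Finset Θ → Prop}
    {inv : Finset Θ → Prop} (hstep : ∀ C C', inv C → step C C' → inv C' ∧ C ⊂ C')
    {C : Finset Θ} (hC : inv C) : LoopHalts step C := by
  rintro ⟨s, h0, hs⟩
  have hinv : ∀ i, inv (s i) := fun i => by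
    induction i with
    | zero => rwa [h0]
    | succ i ih => exact (hstep _ _ ih (hs i)).1
  exact not_strictMono_of_wellFoundedGT s
    (strictMono_nat_of_lt_succ fun i => (hstep _ _ (hinv i) (hs i)).2)

theorem IsWeight.nonempty {Θ : Type*} {C : Finset Θ} {w : Θ → ℝ} (h : IsWeight C w) :
    C.Nonempty := by
  rw [Finset.nonempty_iff_ne_empty]
  rintro rfl
  simpa using h.1

theorem IsWeight.norm_sum_le {Θ E : Type*} [SeminormedAddCommGroup E] [NormedSpace ℝ E]
    {C : Finset Θ} {w : Θ → ℝ} (h : IsWeight C w) {g : Θ → E} {G : ℝ}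
    (hg : ∀ θ ∈ C, ‖g θ‖ ≤ G) : ‖∑ θ ∈ C, w θ • g θ‖ ≤ G :=
  calc ‖∑ θ ∈ C, w θ • g θ‖ ≤ ∑ θ ∈ C, ‖w θ • g θ‖ := _root_.norm_sum_le _ _
    _ ≤ ∑ θ ∈ C, w θ * G := Finset.sum_le_sum fun θ hθ => by
        rw [norm_smul, Real.norm_of_nonneg (h.2 θ hθ)]
        exact mul_le_mul_of_nonneg_left (hg θ hθ) (h.2 θ hθ)
    _ = G := by rw [← Finset.sum_mul, h.1, one_mul]

theorem IsWeight.le_sum {Θ : Type*} {C : Finset Θ} {w : Θ → ℝ} (h : IsWeight C w) {a : Θ → ℝ}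
    {b : ℝ} (ha : ∀ θ ∈ C, b ≤ a θ) : b ≤ ∑ θ ∈ C, w θ * a θ :=
  calc b = ∑ θ ∈ C, w θ * b := by rw [← Finset.sum_mul, h.1, one_mul]
    _ ≤ _ := Finset.sum_le_sum fun θ hθ => mul_le_mul_of_nonneg_left (ha θ hθ) (h.2 θ hθ)

/-- The weighted sums over a nonempty set attain their least norm. -/
theorem exists_isWeight_norm_sum_le {Θ E : Type*} [Fintype Θ] [NormedAddCommGroup E]
    [NormedSpace ℝ E] {C : Finset Θ} (hC : C.Nonempty) (g : Θ → E) :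
    ∃ w, IsWeight C w ∧ ∀ v, IsWeight C v → ‖∑ θ ∈ C, w θ • g θ‖ ≤ ‖∑ θ ∈ C, v θ • g θ‖ := by
  classical
  -- `IsWeight` leaves the values off `C` free; setting them to zero makes the feasible set compact.
  let S : Set (Θ → ℝ) := stdSimplex ℝ Θ ∩ {w | ∀ θ ∉ C, w θ = 0}
  have hcl : IsClosed {w : Θ → ℝ | ∀ θ ∉ C, w θ = 0} := by
    simp only [ofPred_forall]
    exact isClosed_iInter fun θ => isClosed_iInter fun _ =>
      isClosed_eq (continuous_apply θ) continuous_const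
  have hS : IsCompact S := (isCompact_stdSimplex ℝ Θ).inter_right hcl
  have hres : ∀ v, IsWeight C v → (fun θ => if θ ∈ C then v θ else 0) ∈ S := by
    intro v hv
    refine ⟨⟨fun θ => ?_, ?_⟩, fun θ hθ => by simp [hθ]⟩
    · by_cases hθ : θ ∈ C
      · simpa [hθ] using hv.2 θ hθ
      · simp [hθ]
    · simpa [Finset.sum_ite_mem] using hv.1
  have hwt : ∀ w ∈ S, IsWeight C w := by
    intro w hw
    refine ⟨?_, fun θ _ => hw.1.1 θ⟩
    rw [← hw.1.2]
    exact Finset.sum_subset (Finset.subset_univ C) fun θ _ hθ => hw.2 θ hθ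
  obtain ⟨θ₀, hθ₀⟩ := hC
  have hne : S.Nonempty := ⟨_, hres (Pi.single θ₀ 1) ⟨by simp [Pi.single_apply, hθ₀],
    fun θ _ => by by_cases h : θ = θ₀ <;> simp [h]⟩⟩
  have hcont : Continuous fun w : Θ → ℝ => ‖∑ θ ∈ C, w θ • g θ‖ := by fun_prop
  obtain ⟨w, hw, hmin⟩ := hS.exists_isMinOn hne hcont.continuousOn
  refine ⟨w, hwt w hw, fun v hv => (hmin (hres v hv)).trans_eq ?_⟩
  exact congrArg norm (Finset.sum_congr rfl fun θ hθ => by simp [hθ])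

variable {n : ℕ} {Θ : Type*}

theorem exists_isJointGradient [Fintype Θ] (P : BranchedFunction n Θ)
    (x : EuclideanSpace ℝ (Fin n)) {C : Finset Θ} (hC : C.Nonempty) :
    ∃ d, P.IsJointGradient x C d := by
  obtain ⟨w, hw, hmin⟩ := exists_isWeight_norm_sum_le hC fun θ => gradient (P.branch θ) x
  exact ⟨_, w, hw, rfl, fun v hv => by gcongr; exact hmin v hv⟩

/-- Either some weights over `C` annihilate `g`, or the weighted sums are bounded away from `0`. -/
theorem exists_sum_eq_zero_or_le_norm_sum {E : Type*} [Fintype Θ] [NormedAddCommGroup E]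
    [NormedSpace ℝ E] (g : Θ → E) :
    ∃ δ > 0, ∀ C : Finset Θ, (∃ w, IsWeight C w ∧ ∑ θ ∈ C, w θ • g θ = 0) ∨
      ∀ w, IsWeight C w → δ ≤ ‖∑ θ ∈ C, w θ • g θ‖ := by
  classical
  have h : ∀ C : Finset Θ, ∃ δ > 0, (∃ w, IsWeight C w ∧ ∑ θ ∈ C, w θ • g θ = 0) ∨
      ∀ w, IsWeight C w → δ ≤ ‖∑ θ ∈ C, w θ • g θ‖ := by
    intro C
    rcases C.eq_empty_or_nonempty with rfl | hC
    · exact ⟨1, one_pos, .inr fun w hw => by simpa using hw.nonempty⟩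
    · obtain ⟨w, hw, hmin⟩ := exists_isWeight_norm_sum_le hC g
      by_cases h0 : ∑ θ ∈ C, w θ • g θ = 0
      · exact ⟨1, one_pos, .inl ⟨w, hw, h0⟩⟩
      · exact ⟨_, norm_pos_iff.2 h0, .inr hmin⟩
  choose δ hδ hδ' using h
  refine ⟨Finset.univ.inf' Finset.univ_nonempty δ, ?_, fun C => ?_⟩
  · exact (Finset.lt_inf'_iff _).2 fun C _ => hδ C
  · exact (hδ' C).imp_right fun h w hw =>
      (Finset.inf'_le δ (Finset.mem_univ C)).trans (h w hw)

end BranchedFunction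
-- Growth of the function and of joint gradients at the minimizer.
namespace BranchedFunction

variable {n : ℕ} {Θ : Type*}

/-- The gradients of a complete basis admit a vanishing convex combination with positive weights. -/
theorem IsCompleteBasis.exists_pos_weight [Fintype Θ] {P : BranchedFunction n Θ}
    {p : EuclideanSpace ℝ (Fin n)} {B : Finset Θ} (hB : P.IsCompleteBasis p B) :
    ∃ w : Θ → ℝ, IsWeight B w ∧ (∀ θ ∈ B, 0 < w θ) ∧
      ∑ θ ∈ B, w θ • gradient (P.branch θ) p = 0 := by
  classical
  obtain ⟨-, ⟨d, ⟨w, hw, hd, -⟩, hd0⟩, hcase⟩ := hB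
  rw [norm_eq_zero] at hd0
  rw [hd0] at hd
  -- A zero weight could be erased: the smaller set would still have joint gradient zero, against
  -- minimality, or, for a singleton, the weights would not sum to one.
  refine ⟨w, hw, fun θ hθ => (hw.2 θ hθ).lt_of_ne' fun hwθ => ?_, hd.symm⟩
  have hsum : ∑ i ∈ B.erase θ, w i = 1 := by
    rw [← hw.1, ← Finset.add_sum_erase B w hθ, hwθ, zero_add]
  rcases hcase with h1 | hmin
  · obtain ⟨a, rfl⟩ := Finset.card_eq_one.1 h1
    simp_all
  · have hsum' : ∑ i ∈ B.erase θ, w i • gradient (P.branch i) p = 0 := by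
      rw [hd, ← Finset.add_sum_erase B (fun i => w i • gradient (P.branch i) p) hθ, hwθ,
        zero_smul, zero_add]
    have := hmin (B.erase θ) (Finset.erase_ssubset hθ) 0
      ⟨w, ⟨hsum, fun i hi => hw.2 i (Finset.mem_of_mem_erase hi)⟩, hsum'.symm, fun v _ => by
        simp⟩
    simp at this

/-- On the span of a complete basis the largest directional slope is comparable to the norm. -/
theorem IsCompleteBasis.exists_slope [Fintype Θ] {P : BranchedFunction n Θ}
    {p : EuclideanSpace ℝ (Fin n)} {B : Finset Θ} (hB : P.IsCompleteBasis p B) :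
    ∃ c > 0, ∀ u ∈ P.gradSpan p B, ∃ θ ∈ B, c * ‖u‖ ≤ inner ℝ (gradient (P.branch θ) p) u := by
  obtain ⟨w, hw, hwpos, hw0⟩ := hB.exists_pos_weight
  have hne := hw.nonempty
  set φ : EuclideanSpace ℝ (Fin n) → ℝ :=
    fun u => B.sup' hne fun θ => inner ℝ (gradient (P.branch θ) p) u with hφ
  have hcont : Continuous φ := by
    refine Continuous.finset_sup'_apply hne fun θ _ => ?_
    fun_prop
  obtain ⟨c, hc, hle⟩ := exists_pos_mul_norm_pow_le (P.gradSpan p B) hcont one_ne_zero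
    (by simp [hφ]) (fun t ht u => by
      simp only [hφ, inner_smul_right, pow_one]
      exact (Finset.mul₀_sup' ht.le _ _ hne).symm) (fun u hu hu0 => by
      -- If all slopes are nonpositive, the vanishing combination with positive weights forces them
      -- to be zero, so `u` lies in the span and is orthogonal to it.
      by_contra hcon
      have hnonpos : ∀ θ ∈ B, inner ℝ (gradient (P.branch θ) p) u ≤ 0 := fun θ hθ =>
        (Finset.le_sup' (fun θ => inner ℝ (gradient (P.branch θ) p) u) hθ).trans (not_lt.1 hcon)
      have hsum : ∑ θ ∈ B, w θ * inner ℝ (gradient (P.branch θ) p) u = 0 := by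
        have h := congrArg (fun v => inner ℝ v u) hw0
        simpa [sum_inner, inner_smul_left] using h
      have hzero : ∀ θ ∈ B, inner ℝ (gradient (P.branch θ) p) u = 0 := fun θ hθ => by
        have h := (Finset.sum_eq_zero_iff_of_nonpos fun i hi =>
          mul_nonpos_of_nonneg_of_nonpos (hw.2 i hi) (hnonpos i hi)).1 hsum θ hθ
        exact (mul_eq_zero.1 h).resolve_left (hwpos θ hθ).ne'
      have horth : P.gradSpan p B ≤ (ℝ ∙ u)ᗮ := by
        refine Submodule.span_le.2 ?_
        rintro _ ⟨θ, hθ, rfl⟩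
        rw [SetLike.mem_coe, Submodule.mem_orthogonal_singleton_iff_inner_left]
        exact hzero θ hθ
      have := (Submodule.mem_orthogonal_singleton_iff_inner_left).1 (horth hu)
      exact hu0 (inner_self_eq_zero.1 this))
  refine ⟨c, hc, fun u hu => ?_⟩
  obtain ⟨θ, hθ, h⟩ := Finset.exists_mem_eq_sup' hne
    fun θ => inner ℝ (gradient (P.branch θ) p) u
  exact ⟨θ, hθ, by rw [← h]; exact (pow_one ‖u‖ ▸ hle u hu :)⟩

/-- Coercivity of the Hessians of the active branches, up to the component of the direction
along the span of the active gradients. -/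
theorem exists_hessian_coercive [Fintype Θ] {P : BranchedFunction n Θ}
    {p : EuclideanSpace ℝ (Fin n)} (hcpd : P.ComplementaryPosDef p)
    (hdim : P.DimensionConsistent p) :
    ∃ μ > 0, ∃ κ ≥ 0, ∀ θ ∈ P.active p, ∀ e,
      ‖P.hessian θ p‖ ≤ κ ∧
      μ * ‖e‖ ^ 2 ≤ inner ℝ (e - (P.gradSpan p (P.active p)).starProjection e) (P.hessian θ p e)
        + κ * ‖(P.gradSpan p (P.active p)).starProjection e‖ * ‖e‖ := by
  classical
  set V := P.gradSpan p (P.active p) with hV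
  obtain ⟨B, hB, -⟩ := hdim
  have hpd : ∀ θ, ∃ m > 0, θ ∈ P.active p → ∀ u ∈ Vᗮ, m * ‖u‖ ^ 2 ≤ inner ℝ u (P.hessian θ p u) := by
    intro θ
    by_cases hθ : θ ∈ P.active p
    · obtain ⟨m, hm, h⟩ := exists_pos_mul_norm_pow_le Vᗮ
        (φ := fun u => inner ℝ u (P.hessian θ p u)) (by fun_prop) two_ne_zero (by simp)
        (fun t _ u => by simp [inner_smul_left, inner_smul_right]; ring)
        (fun u hu hu0 => hcpd (P.active p).toFinset (by simp)
          ⟨B, fun i hi => by simpa using hB.1 hi, hB⟩ θ (by simpa using hθ) u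
          (by simpa [hV] using hu) hu0)
      exact ⟨m, hm, fun _ => h⟩
    · exact ⟨1, one_pos, fun h => absurd h hθ⟩
  choose m hm hmle using hpd
  obtain ⟨θ₀, -⟩ := hB.exists_pos_weight.choose_spec.1.nonempty
  have hne : (Finset.univ : Finset Θ).Nonempty := ⟨θ₀, Finset.mem_univ _⟩
  set μ := Finset.univ.inf' hne m
  have hμ : 0 < μ := (Finset.lt_inf'_iff _).2 fun θ _ => hm θ
  set h := Finset.univ.sup' hne fun θ => ‖P.hessian θ p‖
  have hle : ∀ θ, ‖P.hessian θ p‖ ≤ h := fun θ =>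
    Finset.le_sup' (fun θ => ‖P.hessian θ p‖) (Finset.mem_univ θ)
  have h0 : 0 ≤ h := (norm_nonneg _).trans (hle θ₀)
  -- In `μ + h`, the term `μ` pays for replacing `‖e - u‖ ^ 2` by `‖e‖ ^ 2`, and `h` for the cross
  -- term with `u`.
  refine ⟨μ, hμ, μ + h, by positivity, fun θ hθ e => ⟨(hle θ).trans (by linarith), ?_⟩⟩
  set u := V.starProjection e with hu
  have hq : e - u ∈ Vᗮ := V.sub_starProjection_mem_orthogonal e
  have hue : ‖u‖ ≤ ‖e‖ := V.norm_starProjection_apply_le e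
  have hqe : ‖e - u‖ ≤ ‖e‖ := by
    rw [hu, ← Submodule.starProjection_orthogonal_val]
    exact Vᗮ.norm_starProjection_apply_le e
  have hpyth : ‖e‖ ^ 2 = ‖u‖ ^ 2 + ‖e - u‖ ^ 2 := by
    rw [hu, ← Submodule.starProjection_orthogonal_val]
    exact Submodule.norm_sq_eq_add_norm_sq_starProjection e V
  have h1 : μ * ‖e - u‖ ^ 2 ≤ inner ℝ (e - u) (P.hessian θ p (e - u)) :=
    (mul_le_mul_of_nonneg_right (Finset.inf'_le m (Finset.mem_univ θ)) (sq_nonneg _)).trans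
      (hmle θ hθ _ hq)
  have h2 : inner ℝ (e - u) (P.hessian θ p e) =
      inner ℝ (e - u) (P.hessian θ p (e - u)) + inner ℝ (e - u) (P.hessian θ p u) := by
    rw [← inner_add_right, ← map_add, sub_add_cancel]
  have h3 : |inner ℝ (e - u) (P.hessian θ p u)| ≤ ‖e‖ * (h * ‖u‖) := by
    refine (abs_real_inner_le_norm _ _).trans ?_
    gcongr
    exact ((P.hessian θ p).le_opNorm u).trans (by gcongr; exact hle θ)
  have h4 := (abs_le.1 h3).1
  nlinarith [mul_le_mul_of_nonneg_left (mul_le_mul_of_nonneg_left hue (norm_nonneg u)) hμ.le]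

theorem IsPiecewiseDifferentiable.differentiableAt {P : BranchedFunction n Θ}
    (hP : P.IsPiecewiseDifferentiable) {θ : Θ} {x : EuclideanSpace ℝ (Fin n)}
    (hx : x ∈ P.dom θ) : DifferentiableAt ℝ (P.branch θ) x :=
  ((hP.contDiffOn θ).differentiableOn one_ne_zero).differentiableAt
    ((hP.isOpen_dom θ).mem_nhds hx)

theorem IsPiecewiseDifferentiable.eventually_differentiableAt {P : BranchedFunction n Θ}
    (hP : P.IsPiecewiseDifferentiable) {θ : Θ} {x : EuclideanSpace ℝ (Fin n)}
    (hx : x ∈ P.dom θ) : ∀ᶠ y in 𝓝 x, DifferentiableAt ℝ (P.branch θ) y :=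
  ((hP.isOpen_dom θ).eventually_mem hx).mono fun _ hy => hP.differentiableAt hy

/-- Near `p`, the branches active at `p` lie below `f`. -/
theorem eventually_branch_le [Fintype Θ] {P : BranchedFunction n Θ}
    (hP : P.IsPiecewiseDifferentiable) {p : EuclideanSpace ℝ (Fin n)}
    (hmax : P.LocallyMaxRepresentable p) :
    ∀ᶠ x in 𝓝 p, ∀ θ ∈ P.active p, x ∈ P.dom θ ∧ P.branch θ x ≤ P.f x := by
  obtain ⟨A, hA, hpA, hgr⟩ := hmax
  have hdom : ∀ᶠ x in 𝓝 p, ∀ θ ∈ P.active p, x ∈ P.dom θ := by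
    refine eventually_all.2 fun θ => ?_
    by_cases hθ : θ ∈ P.active p
    · filter_upwards [(hP.isOpen_dom θ).mem_nhds hθ.1] with x hx _ using hx
    · exact .of_forall fun x h => absurd h hθ
  filter_upwards [hdom, hA.mem_nhds hpA] with x hx hxA θ hθ
  exact ⟨hx θ hθ, (hgr x hxA).2 ⟨θ, hx θ hθ, rfl⟩⟩

/-- Growth of `f` at a minimizer: linear along the active gradients, quadratic otherwise. -/
theorem exists_growth [Fintype Θ] {P : BranchedFunction n Θ}
    (hP : P.IsPiecewiseDifferentiable) (h2 : P.TwiceDifferentiable)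
    {p : EuclideanSpace ℝ (Fin n)} (hmax : P.LocallyMaxRepresentable p)
    (hcpd : P.ComplementaryPosDef p) (hdim : P.DimensionConsistent p) :
    ∃ c > 0, ∀ᶠ x in 𝓝 p,
      c * ‖(P.gradSpan p (P.active p)).starProjection (x - p)‖ + c * ‖x - p‖ ^ 2
        ≤ P.f x - P.f p := by
  obtain ⟨μ, hμ, κ, hκ, hcoer⟩ := exists_hessian_coercive hcpd hdim
  obtain ⟨B, hB, hspan⟩ := hdim
  obtain ⟨c₀, hc₀, hslope⟩ := hB.exists_slope
  rw [hspan] at hslope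
  set V := P.gradSpan p (P.active p) with hV
  have htaylor : ∀ᶠ x in 𝓝 p, ∀ θ ∈ P.active p, |P.branch θ x - P.branch θ p
      - inner ℝ (gradient (P.branch θ) p) (x - p)
      - inner ℝ (x - p) (P.hessian θ p (x - p)) / 2| ≤ μ / 4 * ‖x - p‖ ^ 2 := by
    refine eventually_all.2 fun θ => ?_
    by_cases hθ : θ ∈ P.active p
    · filter_upwards [eventually_abs_sub_second_order_le (h2 θ p hθ.1)
        (hP.eventually_differentiableAt hθ.1) (by positivity : 0 < μ / 4)] with x hx _ using hx
    · exact .of_forall fun x h => absurd h hθ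
  -- Half of the linear growth absorbs the mixed Hessian term `κ * a * ‖e‖`, where `a` is the norm
  -- of the projection.
  have hsmall : ∀ᶠ x in 𝓝 p, κ * ‖x - p‖ < c₀ / 2 := by
    have : Tendsto (fun x => κ * ‖x - p‖) (𝓝 p) (𝓝 (κ * ‖p - p‖)) :=
      (Continuous.tendsto (by fun_prop) p)
    rw [sub_self, norm_zero, mul_zero] at this
    exact this.eventually_lt_const (by positivity)
  refine ⟨min (c₀ / 2) (μ / 4), by positivity, ?_⟩
  filter_upwards [htaylor, hsmall, eventually_branch_le hP hmax] with x hx hxs hxle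
  set e := x - p with he
  -- This branch rises fastest along the projection, and it bounds `f` from below.
  obtain ⟨θ, hθB, hθ⟩ := hslope (V.starProjection e) (V.starProjection_apply_mem e)
  have hθa : θ ∈ P.active p := hB.1 hθB
  have hgV : gradient (P.branch θ) p ∈ V := Submodule.subset_span ⟨θ, hθa, rfl⟩
  have hin : inner ℝ (gradient (P.branch θ) p) (V.starProjection e)
      = inner ℝ (gradient (P.branch θ) p) e := by
    rw [← Submodule.inner_starProjection_left_eq_right,
      Submodule.starProjection_eq_self_iff.2 hgV]
  rw [hin] at hθ
  obtain ⟨hH, hco⟩ := hcoer θ hθa e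
  have h1 := (abs_le.1 (hx θ hθa)).1
  have h2 := (hxle θ hθa).2
  have h3 : P.branch θ p = P.f p := hθa.2
  have h4 : |inner ℝ (V.starProjection e) (P.hessian θ p e)|
      ≤ ‖V.starProjection e‖ * (κ * ‖e‖) := by
    refine (abs_real_inner_le_norm _ _).trans ?_
    gcongr
    exact ((P.hessian θ p).le_opNorm e).trans (by gcongr)
  have h5 := (abs_le.1 h4).1
  rw [inner_sub_left] at hco
  set a := ‖V.starProjection e‖
  have ha : 0 ≤ a := norm_nonneg _
  have h6 := mul_le_mul_of_nonneg_left hxs.le ha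
  have h7 := mul_le_mul_of_nonneg_right (min_le_left (c₀ / 2) (μ / 4)) ha
  have h8 := mul_le_mul_of_nonneg_right (min_le_right (c₀ / 2) (μ / 4)) (sq_nonneg ‖e‖)
  nlinarith

/-- Joint gradients near `p` are bounded below by the distance to `p`, up to the component along
the active gradients. -/
theorem exists_norm_sum_gradient_lower_bound [Fintype Θ] {P : BranchedFunction n Θ}
    (h2 : P.TwiceDifferentiable) {p : EuclideanSpace ℝ (Fin n)}
    (hcpd : P.ComplementaryPosDef p) (hdim : P.DimensionConsistent p) :
    ∃ μ > 0, ∃ κ ≥ 0, ∀ᶠ x in 𝓝 p, ∀ C : Finset Θ, (C : Set Θ) ⊆ P.active p →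
      ∀ w, IsWeight C w → μ * ‖x - p‖ ≤ ‖∑ θ ∈ C, w θ • gradient (P.branch θ) x‖
        + κ * ‖(P.gradSpan p (P.active p)).starProjection (x - p)‖ := by
  obtain ⟨μ, hμ, κ, hκ, hcoer⟩ := exists_hessian_coercive hcpd hdim
  set V := P.gradSpan p (P.active p) with hV
  have hgrad : ∀ᶠ x in 𝓝 p, ∀ θ ∈ P.active p, ‖gradient (P.branch θ) x
      - gradient (P.branch θ) p - P.hessian θ p (x - p)‖ ≤ μ / 2 * ‖x - p‖ := by
    refine eventually_all.2 fun θ => ?_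
    by_cases hθ : θ ∈ P.active p
    · filter_upwards [eventually_norm_gradient_sub_le (h2 θ p hθ.1)
        (by positivity : 0 < μ / 2)] with x hx _ using hx
    · exact .of_forall fun x h => absurd h hθ
  refine ⟨μ / 2, by positivity, κ, hκ, ?_⟩
  filter_upwards [hgrad] with x hx C hC w hw
  set e := x - p with he
  set u := V.starProjection e with hu
  by_cases he0 : ‖e‖ = 0
  · rw [he0, mul_zero]
    positivity
  have hepos : 0 < ‖e‖ := (norm_nonneg _).lt_of_ne' he0
  have hqe : ‖e - u‖ ≤ ‖e‖ := by
    rw [hu, ← Submodule.starProjection_orthogonal_val]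
    exact Vᗮ.norm_starProjection_apply_le e
  have hq : e - u ∈ Vᗮ := V.sub_starProjection_mem_orthogonal e
  -- The test vector `e - u` is orthogonal to every active gradient at `p`, so only the coercive
  -- second-order part survives.
  have key : μ / 2 * ‖e‖ ^ 2 - κ * ‖u‖ * ‖e‖
      ≤ ∑ θ ∈ C, w θ * inner ℝ (gradient (P.branch θ) x) (e - u) := by
    refine hw.le_sum fun θ hθ => ?_
    have hθa := hC hθ
    have hgV : gradient (P.branch θ) p ∈ V := Submodule.subset_span ⟨θ, hθa, rfl⟩
    have h0 : inner ℝ (gradient (P.branch θ) p) (e - u) = 0 :=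
      (Submodule.mem_orthogonal _ _).1 hq _ hgV
    have h1 := (hcoer θ hθa e).2
    have h3 : |inner ℝ (gradient (P.branch θ) x - gradient (P.branch θ) p - P.hessian θ p e)
        (e - u)| ≤ μ / 2 * ‖e‖ * ‖e‖ :=
      (abs_real_inner_le_norm _ _).trans (by gcongr; exact hx θ hθa)
    rw [inner_sub_left, inner_sub_left, h0, real_inner_comm (e - u) (P.hessian θ p e)] at h3
    have h4 := (abs_le.1 h3).1
    nlinarith
  have h5 : ∑ θ ∈ C, w θ * inner ℝ (gradient (P.branch θ) x) (e - u)
      ≤ ‖∑ θ ∈ C, w θ • gradient (P.branch θ) x‖ * ‖e‖ :=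
    calc _ = inner ℝ (∑ θ ∈ C, w θ • gradient (P.branch θ) x) (e - u) := by
          simp [sum_inner, inner_smul_left]
      _ ≤ _ := (real_inner_le_norm _ _).trans (by gcongr)
  refine le_of_mul_le_mul_right ?_ hepos
  nlinarith

/-! ### The local model: all constants on one ball. -/

/-- Quantitative description of `f` on the ball of radius `r` around the minimizer `p`. -/
structure LocalModel (P : BranchedFunction n Θ) (p : EuclideanSpace ℝ (Fin n))
    (L r c μ κ G δ : ℝ) : Prop where
  L_nonneg : 0 ≤ L
  r_pos : 0 < r
  c_pos : 0 < c
  μ_pos : 0 < μ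
  κ_nonneg : 0 ≤ κ
  G_nonneg : 0 ≤ G
  δ_pos : 0 < δ
  exists_active : ∀ x, (P.active x).Nonempty
  active_subset : ∀ x ∈ Metric.ball p r, P.active x ⊆ P.active p
  mem_dom : ∀ x ∈ Metric.ball p r, ∀ θ ∈ P.active p, x ∈ P.dom θ
  branch_le : ∀ x ∈ Metric.ball p r, ∀ θ ∈ P.active p, P.branch θ x ≤ P.f x
  taylor : ∀ x ∈ Metric.ball p r, ∀ y ∈ Metric.ball p r, ∀ θ ∈ P.active p,
    |P.branch θ y - P.branch θ x - inner ℝ (gradient (P.branch θ) x) (y - x)| ≤ L * ‖y - x‖ ^ 2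
  norm_gradient_le : ∀ x ∈ Metric.ball p r, ∀ θ ∈ P.active p, ‖gradient (P.branch θ) x‖ ≤ G
  norm_gradient_sub_le : ∀ x ∈ Metric.ball p r, ∀ θ ∈ P.active p,
    ‖gradient (P.branch θ) x - gradient (P.branch θ) p‖ ≤ L * ‖x - p‖
  growth : ∀ x ∈ Metric.ball p r, c * ‖x - p‖ ^ 2 ≤ P.f x - P.f p
  dual : ∀ x ∈ Metric.ball p r, ∀ C : Finset Θ, (C : Set Θ) ⊆ P.active p →
    ∀ w, IsWeight C w → μ * ‖x - p‖ ≤ ‖∑ θ ∈ C, w θ • gradient (P.branch θ) x‖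
      + κ * (P.f x - P.f p)
  dichotomy : ∀ C : Finset Θ,
    (∃ w, IsWeight C w ∧ ∑ θ ∈ C, w θ • gradient (P.branch θ) p = 0) ∨
      ∀ w, IsWeight C w → δ ≤ ‖∑ θ ∈ C, w θ • gradient (P.branch θ) p‖

/-- The growth bound trades the projection norm for the gap divided by `c`, hence the constant `κ /
c`. The ball is convex and lies in every active domain, so the Taylor bound needs no convexity of
the domains. -/
theorem exists_localModel [Fintype Θ] {P : BranchedFunction n Θ}
    (hP : P.IsPiecewiseDifferentiable) {L : NNReal}
    (hL : ∀ θ, LipschitzOnWith L (gradient (P.branch θ)) (P.dom θ))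
    (h2 : P.TwiceDifferentiable) {p : EuclideanSpace ℝ (Fin n)}
    (hmax : P.LocallyMaxRepresentable p) (hcpd : P.ComplementaryPosDef p)
    (hdim : P.DimensionConsistent p) :
    ∃ r c μ κ G δ : ℝ, P.LocalModel p L r c μ κ G δ := by
  obtain ⟨c, hc, hgrowth⟩ := exists_growth hP h2 hmax hcpd hdim
  obtain ⟨μ, hμ, κ, hκ, hdual⟩ := exists_norm_sum_gradient_lower_bound h2 hcpd hdim
  obtain ⟨δ, hδ, hdich⟩ := exists_sum_eq_zero_or_le_norm_sum fun θ => gradient (P.branch θ) p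
  obtain ⟨r₀, hr₀, hball₀⟩ := Metric.eventually_nhds_iff_ball.1
    ((hP.active_subset p).and ((eventually_branch_le hP hmax).and (hgrowth.and hdual)))
  -- The cap at `1` serves only to bound the gradients by a constant.
  set r := min r₀ 1
  have hr : 0 < r := lt_min hr₀ one_pos
  have hball := fun x (hx : x ∈ Metric.ball p r) =>
    hball₀ x (Metric.ball_subset_ball (min_le_left _ _) hx)
  have hlip : ∀ x ∈ Metric.ball p r, ∀ θ ∈ P.active p,
      ‖gradient (P.branch θ) x - gradient (P.branch θ) p‖ ≤ L * ‖x - p‖ := fun x hx θ hθ =>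
    (hL θ).norm_sub_le ((hball x hx).2.1 θ hθ).1 hθ.1
  refine ⟨r, c, μ, κ / c, ∑ θ, ‖gradient (P.branch θ) p‖ + L, δ, ?_⟩
  exact
    { L_nonneg := L.2
      r_pos := hr
      c_pos := hc
      μ_pos := hμ
      κ_nonneg := by positivity
      G_nonneg := by positivity
      δ_pos := hδ
      exists_active := hP.exists_active
      active_subset := fun x hx => (hball x hx).1
      mem_dom := fun x hx θ hθ => ((hball x hx).2.1 θ hθ).1
      branch_le := fun x hx θ hθ => ((hball x hx).2.1 θ hθ).2
      taylor := fun x hx y hy θ hθ => by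
        have hsub : Metric.ball p r ⊆ P.dom θ := fun z hz => ((hball z hz).2.1 θ hθ).1
        exact abs_sub_sub_inner_gradient_le ((hL θ).mono hsub)
          (fun z hz => hP.differentiableAt (hsub hz)) (convex_ball p r) hx hy
      norm_gradient_le := fun x hx θ hθ => by
        have h1 := norm_le_norm_add_norm_sub (gradient (P.branch θ) p) (gradient (P.branch θ) x)
        have h3 := hlip x hx θ hθ
        have h4 := Finset.single_le_sum (f := fun θ => ‖gradient (P.branch θ) p‖)
          (fun i _ => norm_nonneg _) (Finset.mem_univ θ)
        have h5 : ‖x - p‖ ≤ 1 := ((mem_ball_iff_norm.1 hx).trans_le (min_le_right _ _)).le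
        have h6 := mul_le_mul_of_nonneg_left h5 L.2
        rw [norm_sub_rev] at h1
        simp only [NNReal.val_eq_coe] at h6
        linarith
      norm_gradient_sub_le := hlip
      growth := fun x hx => by
        have h1 := (hball x hx).2.2.1
        have h3 : 0 ≤ c * ‖(P.gradSpan p (P.active p)).starProjection (x - p)‖ := by positivity
        linarith
      dual := fun x hx C hC w hw => by
        refine ((hball x hx).2.2.2 C hC w hw).trans ?_
        have h1 := (hball x hx).2.2.1
        rw [div_mul_eq_mul_div, mul_div_assoc]
        gcongr
        rw [le_div_iff₀ hc, mul_comm]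
        have h3 : 0 ≤ c * ‖x - p‖ ^ 2 := by positivity
        linarith
      dichotomy := hdich }

end BranchedFunction
-- The two subproblems and the decrease they provide.
namespace BranchedFunction

variable {n : ℕ} {Θ : Type*}

/-- Variational inequality for the joint gradient. -/
theorem IsJointGradient.norm_sq_le_inner {P : BranchedFunction n Θ}
    {x d : EuclideanSpace ℝ (Fin n)} {C : Finset Θ} (hd : P.IsJointGradient x C d) {θ : Θ}
    (hθ : θ ∈ C) : ‖d‖ ^ 2 ≤ inner ℝ (gradient (P.branch θ) x) d := by
  classical
  obtain ⟨w, hw, hdw, hmin⟩ := hd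
  set g := gradient (P.branch θ) x with hg
  have key : ∀ t ∈ Icc (0 : ℝ) 1, ‖d‖ ^ 2 ≤ ‖d + t • (g - d)‖ ^ 2 := by
    intro t ht
    have hv : IsWeight C fun i => (1 - t) * w i + t * (if i = θ then 1 else 0) := by
      refine ⟨?_, fun i hi => ?_⟩
      · rw [Finset.sum_add_distrib, ← Finset.mul_sum, ← Finset.mul_sum, hw.1]
        simp [hθ]
      · have h1 := mul_nonneg (sub_nonneg.2 ht.2) (hw.2 i hi)
        have h2 : 0 ≤ t * (if i = θ then 1 else 0) := by
          split_ifs <;> simp [ht.1]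
        exact add_nonneg h1 h2
    have h := hmin _ hv
    have hsum : ∑ i ∈ C, ((1 - t) * w i + t * (if i = θ then 1 else 0)) •
        gradient (P.branch i) x = d + t • (g - d) := by
      simp only [add_smul, Finset.sum_add_distrib, mul_smul, ← Finset.smul_sum, ← hdw]
      simp only [ite_smul, one_smul, zero_smul, Finset.sum_ite_eq', hθ, if_true, ← hg]
      module
    rwa [hsum] at h
  by_contra! hcon
  set a := inner ℝ d (g - d) with ha
  have ha' : a < 0 := by
    rw [ha, inner_sub_right, real_inner_self_eq_norm_sq, real_inner_comm]
    linarith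
  set b := ‖g - d‖ ^ 2 with hb
  have hb0 : 0 ≤ b := sq_nonneg _
  have hba : 0 < b - a := by linarith
  -- This `t` lies in `(0, 1]` even if `b = 0`, and makes `2 * a + t * b = a * (1 + t)` negative.
  set t := -a / (b - a) with ht
  have ht0 : 0 < t := div_pos (by linarith) hba
  have htm : t * (b - a) = -a := div_mul_cancel₀ _ hba.ne'
  have ht1 : t ≤ 1 := (div_le_one hba).2 (by linarith)
  have h := key t ⟨ht0.le, ht1⟩
  rw [norm_add_sq_real, inner_smul_right, norm_smul, Real.norm_of_nonneg ht0.le, mul_pow,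
    ← ha, ← hb] at h
  have h2 : 0 ≤ t * (2 * a + t * b) := by linarith
  have h3 : 0 ≤ 2 * a + t * b := nonneg_of_mul_nonneg_right h2 ht0
  nlinarith

/-- On a sublevel set the quartic term bounds `s`, and the residual of a single branch then bounds
`z`. -/
theorem IsRecoverySolution.exists_of_nonempty (P : BranchedFunction n Θ)
    (x : EuclideanSpace ℝ (Fin n)) {C : Finset Θ} (hC : C.Nonempty) :
    ∃ z s, P.IsRecoverySolution x C z s := by
  obtain ⟨θ, hθ⟩ := hC
  set φ : ℝ × EuclideanSpace ℝ (Fin n) → ℝ := fun y => P.recoveryObjective x C y.1 y.2 with hφ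
  have hcont : Continuous φ := by
    simp only [hφ, recoveryObjective]
    fun_prop
  set R := φ (0, 0)
  set g := gradient (P.branch θ) x
  have hnn : ∀ y : ℝ × EuclideanSpace ℝ (Fin n), ∀ i ∈ C,
      0 ≤ (y.1 + inner ℝ (gradient (P.branch i) x) y.2 - P.branch i x) ^ 2 :=
    fun _ _ _ => sq_nonneg _
  have hbdd : ∀ y, φ y ≤ R → y ∈ Metric.closedBall (0 : ℝ × EuclideanSpace ℝ (Fin n))
      ((R + 1) + ‖g‖ * (R + 1) + |P.branch θ x|) := by
    intro y hy
    have h1 := Finset.sum_nonneg (hnn y)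
    have h2 := Finset.single_le_sum (hnn y) hθ
    have h3 : 0 ≤ ‖y.2‖ ^ 4 := by positivity
    have h4 : φ y = ∑ i ∈ C, (y.1 + inner ℝ (gradient (P.branch i) x) y.2 - P.branch i x) ^ 2
      + ‖y.2‖ ^ 4 := rfl
    have hR : 0 ≤ R := by linarith
    have hs : ‖y.2‖ ≤ R + 1 := by
      by_contra! hcon
      have h5 : (R + 1) ^ 4 ≤ ‖y.2‖ ^ 4 := by gcongr
      have h6 : R + 1 ≤ (R + 1) ^ 4 := le_self_pow₀ (by linarith) (by norm_num)
      linarith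
    have hres : |y.1 + inner ℝ g y.2 - P.branch θ x| ≤ R + 1 :=
      abs_le_of_sq_le_sq (by nlinarith) (by linarith)
    have hin : |inner ℝ g y.2| ≤ ‖g‖ * (R + 1) :=
      (abs_real_inner_le_norm _ _).trans (by gcongr)
    have hz : |y.1| ≤ (R + 1) + ‖g‖ * (R + 1) + |P.branch θ x| := by
      rw [abs_le] at *
      have h7 := neg_abs_le (P.branch θ x)
      have h8 := le_abs_self (P.branch θ x)
      constructor <;> linarith
    rw [mem_closedBall_zero_iff, Prod.norm_def]
    refine max_le hz (hs.trans ?_)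
    have : 0 ≤ ‖g‖ * (R + 1) + |P.branch θ x| := by positivity
    linarith
  obtain ⟨y, hy⟩ := hcont.exists_forall_le' (0, 0) (by
    filter_upwards [(isCompact_closedBall (0 : ℝ × EuclideanSpace ℝ (Fin n))
      ((R + 1) + ‖g‖ * (R + 1) + |P.branch θ x|)).compl_mem_cocompact] with y hy
    by_contra! hcon
    exact hy (hbdd y hcon.le))
  exact ⟨y.1, y.2, fun z' s' => hy (z', s')⟩

namespace LocalModel

variable {P : BranchedFunction n Θ} {p x : EuclideanSpace ℝ (Fin n)} {L r c μ κ G δ : ℝ}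

/-- The pair `(f p, x - p)` thus has residuals of order `‖x - p‖ ^ 2`; it is the competitor in the
recovery program. -/
theorem taylor_center (m : P.LocalModel p L r c μ κ G δ) (hx : x ∈ Metric.ball p r) {θ : Θ}
    (hθ : θ ∈ P.active p) :
    |P.f p + inner ℝ (gradient (P.branch θ) x) (x - p) - P.branch θ x| ≤ L * ‖x - p‖ ^ 2 := by
  have h := m.taylor x hx p (Metric.mem_ball_self m.r_pos) θ hθ
  rw [← neg_sub x p, inner_neg_right, norm_neg, hθ.2] at h
  convert h using 2
  ring

/-- Solutions of the direction-recovery program near the minimizer. -/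
theorem recovery_bounds [Fintype Θ] (m : P.LocalModel p L r c μ κ G δ)
    (hx : x ∈ Metric.ball p r) {K : ℝ} (hK : K = Fintype.card Θ * L ^ 2 + 1) {C : Finset Θ}
    (hC : (C : Set Θ) ⊆ P.active p) {z : ℝ} {s : EuclideanSpace ℝ (Fin n)}
    (hs : P.IsRecoverySolution x C z s) :
    ‖s‖ ≤ K * ‖x - p‖ ∧ ∀ θ ∈ C,
      |z + inner ℝ (gradient (P.branch θ) x) s - P.branch θ x| ≤ K * ‖x - p‖ ^ 2 := by
  set e := x - p with he
  have hK1 : 1 ≤ K := by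
    rw [hK]
    have : 0 ≤ Fintype.card Θ * L ^ 2 := by positivity
    linarith
  -- Squared residuals and the quartic penalty of the competitor are both of order `‖e‖ ^ 4`; this
  -- is where `K` comes from.
  have hobj : P.recoveryObjective x C z s ≤ K * ‖e‖ ^ 4 := by
    refine (hs (P.f p) e).trans ?_
    have h1 : ∑ θ ∈ C, (P.f p + inner ℝ (gradient (P.branch θ) x) e - P.branch θ x) ^ 2
        ≤ ∑ _θ ∈ C, (L * ‖e‖ ^ 2) ^ 2 :=
      Finset.sum_le_sum fun θ hθ => by
        rw [← sq_abs]
        gcongr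
        exact m.taylor_center hx (hC hθ)
    rw [Finset.sum_const, nsmul_eq_mul] at h1
    have h2 : (C.card : ℝ) * (L * ‖e‖ ^ 2) ^ 2 ≤ Fintype.card Θ * (L * ‖e‖ ^ 2) ^ 2 := by
      gcongr
      exact Finset.card_le_univ C
    rw [recoveryObjective, hK]
    linarith
  have hnn : ∀ i ∈ C, 0 ≤ (z + inner ℝ (gradient (P.branch i) x) s - P.branch i x) ^ 2 :=
    fun _ _ => sq_nonneg _
  have hsum := Finset.sum_nonneg hnn
  rw [recoveryObjective] at hobj
  have h0 : 0 ≤ ‖e‖ ^ 4 := by positivity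
  refine ⟨?_, fun θ hθ => ?_⟩
  · refine le_of_pow_le_pow_left₀ (n := 4) (by norm_num) (by positivity) ?_
    rw [mul_pow]
    have : K * ‖e‖ ^ 4 ≤ K ^ 4 * ‖e‖ ^ 4 := by
      gcongr
      exact le_self_pow₀ hK1 (by norm_num)
    linarith
  · refine abs_le_of_sq_le_sq ?_ (by positivity)
    have h1 := Finset.single_le_sum hnn hθ
    have h2 : 0 ≤ ‖s‖ ^ 4 := by positivity
    have h3 : K * ‖e‖ ^ 4 ≤ K ^ 2 * ‖e‖ ^ 4 := by
      gcongr
      exact le_self_pow₀ hK1 (by norm_num)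
    calc _ ≤ K ^ 2 * ‖e‖ ^ 4 := by linarith
      _ = _ := by ring

/-- Decrease obtained from a recovered direction when the current branches contain a vanishing
convex combination of gradients at the minimizer. -/
theorem f_sub_smul_le [Fintype Θ] (m : P.LocalModel p L r c μ κ G δ)
    (hx : x ∈ Metric.ball p r) {K : ℝ} (hK : K = Fintype.card Θ * L ^ 2 + 1)
    {γ : ℝ} (hγ : γ ∈ Ioo (0 : ℝ) 1) {C C' : Finset Θ}
    (hCC' : C ⊆ C') (hC' : (C' : Set Θ) ⊆ P.active p) {z : ℝ} {s : EuclideanSpace ℝ (Fin n)}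
    (hs : P.IsRecoverySolution x C' z s) {w : Θ → ℝ} (hw : IsWeight C w)
    (hw0 : ∑ θ ∈ C, w θ • gradient (P.branch θ) p = 0) (hxs : x - γ • s ∈ Metric.ball p r)
    {θ : Θ} (hθ : θ ∈ C') (hθa : θ ∈ P.active (x - γ • s)) :
    P.f (x - γ • s) - P.f p ≤ (1 - γ) * (P.f x - P.f p)
      + (2 * K + 2 * L + L * K + L * K ^ 2) * ‖x - p‖ ^ 2 := by
  obtain ⟨hsn, hres⟩ := m.recovery_bounds hx hK hC' hs
  have hL := m.L_nonneg
  have hK1 : 0 < K := by rw [hK]; positivity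
  set e := x - p with he
  have hes : ‖e - s‖ ≤ (1 + K) * ‖e‖ := (norm_sub_le _ _).trans (by linarith)
  -- Averaging the residuals with the weights `w` cancels the gradients at `p`, so `z` exceeds `f p`
  -- by at most second order.
  have hz : z - P.f p ≤ (K + L + L * (1 + K)) * ‖e‖ ^ 2 := by
    have h1 : z - P.f p - (K + L + L * (1 + K)) * ‖e‖ ^ 2 ≤
        ∑ i ∈ C, w i * inner ℝ (gradient (P.branch i) p) (e - s) := by
      refine hw.le_sum fun i hi => ?_
      have hia := hC' (hCC' hi)
      have h2 := (abs_le.1 (hres i (hCC' hi))).2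
      have h3 := (abs_le.1 (m.taylor_center hx hia)).1
      have h4 : |inner ℝ (gradient (P.branch i) x - gradient (P.branch i) p) (e - s)|
          ≤ (L * ‖e‖) * ((1 + K) * ‖e‖) := by
        refine (abs_real_inner_le_norm _ _).trans ?_
        gcongr
        exact m.norm_gradient_sub_le x hx i hia
      have h5 := (abs_le.1 h4).2
      rw [inner_sub_left, inner_sub_right] at h5
      rw [← he] at h3
      nlinarith
    have h6 : ∑ i ∈ C, w i * inner ℝ (gradient (P.branch i) p) (e - s) = 0 := by
      have h := congrArg (fun v => inner ℝ v (e - s)) hw0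
      simpa only [sum_inner, real_inner_smul_left, inner_zero_left] using h
    linarith
  have hθp := hC' hθ
  -- The branch `θ` is active at the new point, so `f` there is at most `(1 - γ) f_θ x + γ z` up to
  -- second order.
  have h1 := (abs_le.1 (m.taylor x hx _ hxs θ hθp)).2
  rw [hθa.2, show x - γ • s - x = -(γ • s) by abel, inner_neg_right, norm_neg,
    real_inner_smul_right, norm_smul, Real.norm_of_nonneg hγ.1.le] at h1
  have h2 := mul_le_mul_of_nonneg_left (abs_le.1 (hres θ hθ)).1 hγ.1.le
  have h3 := mul_le_mul_of_nonneg_left hz hγ.1.le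
  have h4 := mul_le_mul_of_nonneg_left (m.branch_le x hx θ hθp) (sub_nonneg.2 hγ.2.le)
  have h5 : (γ * ‖s‖) ^ 2 ≤ (K * ‖e‖) ^ 2 :=
    pow_le_pow_left₀ (mul_nonneg hγ.1.le (norm_nonneg _))
      ((mul_le_of_le_one_left (norm_nonneg _) hγ.2.le).trans hsn) 2
  have h6 := mul_le_mul_of_nonneg_left h5 hL
  have h7 : γ * ((2 * K + 2 * L + L * K) * ‖e‖ ^ 2) ≤ (2 * K + 2 * L + L * K) * ‖e‖ ^ 2 :=
    mul_le_of_le_one_left (by positivity) hγ.2.le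
  nlinarith

theorem norm_le_of_isJointGradient (m : P.LocalModel p L r c μ κ G δ)
    (hx : x ∈ Metric.ball p r) {C : Finset Θ} (hC : (C : Set Θ) ⊆ P.active p)
    {d : EuclideanSpace ℝ (Fin n)} (hd : P.IsJointGradient x C d) : ‖d‖ ≤ G := by
  obtain ⟨w, hw, rfl, -⟩ := hd
  exact hw.norm_sum_le fun θ hθ => m.norm_gradient_le x hx θ (hC hθ)

/-- A point at which a branch of the current set is active gives sufficient decrease. -/
theorem sufficientDecrease_of_mem (m : P.LocalModel p L r c μ κ G δ)
    (hx : x ∈ Metric.ball p r) {C : Finset Θ} (hC : (C : Set Θ) ⊆ P.active p)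
    {d : EuclideanSpace ℝ (Fin n)} (hd : P.IsJointGradient x C d) (hd0 : ‖d‖ ≠ 0) {ρ₀ α : ℝ}
    (hα : 0 < α) (hαL : L * α ≤ 1 - ρ₀) (hxd : x - α • d ∈ Metric.ball p r) {θ : Θ}
    (hθ : θ ∈ C) (hθa : θ ∈ P.active (x - α • d)) : P.SufficientDecrease ρ₀ α x d := by
  have h1 := (abs_le.1 (m.taylor x hx _ hxd θ (hC hθ))).2
  rw [hθa.2, show x - α • d - x = -(α • d) by abel, inner_neg_right, norm_neg,
    real_inner_smul_right, norm_smul, Real.norm_of_nonneg hα.le] at h1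
  -- The slope along `d` is at least `‖d‖ ^ 2`, so the Taylor error costs only the fraction `L * α`
  -- of the gain.
  have h2 := mul_le_mul_of_nonneg_left (hd.norm_sq_le_inner hθ) hα.le
  have h3 := m.branch_le x hx θ (hC hθ)
  have hd1 : 0 < ‖d‖ := (norm_nonneg d).lt_of_ne' hd0
  have h4 := mul_le_mul_of_nonneg_right hαL (by positivity : 0 ≤ α * ‖d‖ ^ 2)
  rw [SufficientDecrease, le_div_iff₀ (by positivity)]
  nlinarith

theorem sub_smul_mem_ball (hx : x ∈ Metric.ball p (r / 2)) {v : EuclideanSpace ℝ (Fin n)}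
    {t : ℝ} (ht : 0 ≤ t) (hv : t * ‖v‖ ≤ r / 2) : x - t • v ∈ Metric.ball p r := by
  rw [mem_ball_iff_norm] at *
  have h1 := norm_sub_le (x - p) (t • v)
  rw [norm_smul, Real.norm_of_nonneg ht] at h1
  rw [sub_right_comm]
  linarith

theorem sub_smul_recovery_mem_ball [Fintype Θ] {γ K : ℝ} (m : P.LocalModel p L r c μ κ G δ)
    (hx : x ∈ Metric.ball p (r / 2)) (hK : K = Fintype.card Θ * L ^ 2 + 1)
    (hKx : K * ‖x - p‖ ≤ r / 2) (hγ : γ ∈ Ioo (0 : ℝ) 1) {C : Finset Θ}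
    (hC : (C : Set Θ) ⊆ P.active p) {z : ℝ} {s : EuclideanSpace ℝ (Fin n)}
    (hs : P.IsRecoverySolution x C z s) : x - γ • s ∈ Metric.ball p r := by
  have hxr : x ∈ Metric.ball p r := Metric.ball_subset_ball (by linarith [m.r_pos]) hx
  exact sub_smul_mem_ball hx hγ.1.le ((mul_le_of_le_one_left (norm_nonneg _) hγ.2.le).trans
    ((m.recovery_bounds hxr hK hC hs).1.trans hKx))

/-! ### One iteration: termination and contraction. -/

section Steps

variable [DecidableEq Θ] {ρ₀ α γ K : ℝ}

/-- A trial point with an active branch in `C` would already give sufficient decrease, so the branch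
found is new. The trial point is near `p`, so the branch is also feasible at `x`, and the set never
stays unchanged. -/
theorem selectionStep_ssubset (m : P.LocalModel p L r c μ κ G δ)
    (hx : x ∈ Metric.ball p (r / 2)) (hα : 0 < α) (hαL : L * α ≤ 1 - ρ₀)
    (hαG : α * G ≤ r / 2) {C C' : Finset Θ} (hC : (C : Set Θ) ⊆ P.active p)
    (h : P.SelectionStep ρ₀ α x C C') : (C' : Set Θ) ⊆ P.active p ∧ C ⊂ C' := by
  have hxr : x ∈ Metric.ball p r := Metric.ball_subset_ball (by linarith [m.r_pos]) hx
  obtain ⟨d, hd, hd0, hsuf, θ, hθ, hcase⟩ := h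
  have hxd : x - α • d ∈ Metric.ball p r := sub_smul_mem_ball hx hα.le
    ((mul_le_mul_of_nonneg_left (m.norm_le_of_isJointGradient hxr hC hd) hα.le).trans hαG)
  have hθp := m.active_subset _ hxd hθ
  have hθC : θ ∉ C := fun hmem =>
    hsuf (m.sufficientDecrease_of_mem hxr hC hd hd0 hα hαL hxd hmem hθ)
  rcases hcase with ⟨-, rfl⟩ | ⟨hnf, -⟩
  · exact ⟨by simpa [insert_subset_iff] using ⟨hθp, hC⟩, Finset.ssubset_insert hθC⟩
  · exact absurd (m.mem_dom x hxr θ hθp) hnf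

theorem gapStep_ssubset [Fintype Θ] (m : P.LocalModel p L r c μ κ G δ)
    (hx : x ∈ Metric.ball p (r / 2)) (hK : K = Fintype.card Θ * L ^ 2 + 1)
    (hKx : K * ‖x - p‖ ≤ r / 2) (hγ : γ ∈ Ioo (0 : ℝ) 1) {C C' : Finset Θ}
    (hC : (C : Set Θ) ⊆ P.active p) (h : P.GapStep γ x C C') :
    (C' : Set Θ) ⊆ P.active p ∧ C ⊂ C' := by
  obtain ⟨z, s, hs, hemp, θ, hθ, rfl⟩ := h
  have hθp := m.active_subset _ (m.sub_smul_recovery_mem_ball hx hK hKx hγ hC hs) hθ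
  have hθC : θ ∉ C := fun hmem => (hemp ▸ ⟨hθ, hmem⟩ : θ ∈ (∅ : Set Θ))
  exact ⟨by simpa [insert_subset_iff] using ⟨hθp, hC⟩, Finset.ssubset_insert hθC⟩

theorem selectionReturns_subset (m : P.LocalModel p L r c μ κ G δ)
    (hx : x ∈ Metric.ball p (r / 2)) (hα : 0 < α) (hαL : L * α ≤ 1 - ρ₀)
    (hαG : α * G ≤ r / 2) {C : Finset Θ} {d : EuclideanSpace ℝ (Fin n)}
    (h : P.SelectionReturns ρ₀ α x C d) : (C : Set Θ) ⊆ P.active p := by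
  have hxr : x ∈ Metric.ball p r := Metric.ball_subset_ball (by linarith [m.r_pos]) hx
  obtain ⟨⟨θ, hθ, hreach⟩, -⟩ := h
  induction hreach with
  | refl => simpa using m.active_subset x hxr hθ
  | tail _ hstep ih => exact (m.selectionStep_ssubset hx hα hαL hαG ih hstep).1

theorem gap_reachable_subset [Fintype Θ] (m : P.LocalModel p L r c μ κ G δ)
    (hx : x ∈ Metric.ball p (r / 2)) (hK : K = Fintype.card Θ * L ^ 2 + 1)
    (hKx : K * ‖x - p‖ ≤ r / 2) (hγ : γ ∈ Ioo (0 : ℝ) 1) {C C' : Finset Θ}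
    (hC : (C : Set Θ) ⊆ P.active p) (h : Relation.ReflTransGen (P.GapStep γ x) C C') :
    (C' : Set Θ) ⊆ P.active p ∧ C ⊆ C' := by
  induction h with
  | refl => exact ⟨hC, subset_rfl⟩
  | tail _ hstep ih =>
    obtain ⟨h1, h2⟩ := m.gapStep_ssubset hx hK hKx hγ ih.1 hstep
    exact ⟨h1, ih.2.trans h2.subset⟩

theorem wellDefinedAt [Fintype Θ] (m : P.LocalModel p L r c μ κ G δ)
    (hx : x ∈ Metric.ball p (r / 2)) (hα : 0 < α) (hαL : L * α ≤ 1 - ρ₀)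
    (hαG : α * G ≤ r / 2) (hK : K = Fintype.card Θ * L ^ 2 + 1)
    (hKx : K * ‖x - p‖ ≤ r / 2) (hγ : γ ∈ Ioo (0 : ℝ) 1) :
    P.EBIGDWellDefinedAt ρ₀ α γ x := by
  have hxr : x ∈ Metric.ball p r := Metric.ball_subset_ball (by linarith [m.r_pos]) hx
  refine ⟨fun θ hθ => loopHalts_of_ssubset (inv := fun C => (C : Set Θ) ⊆ P.active p)
    (fun C C' hC h => m.selectionStep_ssubset hx hα hαL hαG hC h)
    (by simpa using m.active_subset x hxr hθ), fun C d h => ?_⟩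
  have hC := m.selectionReturns_subset hx hα hαL hαG h
  refine ⟨loopHalts_of_ssubset (inv := fun C => (C : Set Θ) ⊆ P.active p)
    (fun C C' hC h => m.gapStep_ssubset hx hK hKx hγ hC h) hC, fun C' h' θ hθ => ?_⟩
  exact m.mem_dom x hxr θ ((m.gap_reachable_subset hx hK hKx hγ hC h').1 hθ)

/-- The loops are run to the end with nonemptiness as part of the invariant, since it supplies
solutions of both subproblems. -/
theorem exists_step [Fintype Θ] (m : P.LocalModel p L r c μ κ G δ)
    (hx : x ∈ Metric.ball p (r / 2)) (hα : 0 < α) (hαL : L * α ≤ 1 - ρ₀)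
    (hαG : α * G ≤ r / 2) (hK : K = Fintype.card Θ * L ^ 2 + 1)
    (hKx : K * ‖x - p‖ ≤ r / 2) (hγ : γ ∈ Ioo (0 : ℝ) 1) :
    ∃ y, P.EBIGDStep ρ₀ α γ x y := by
  have hxr : x ∈ Metric.ball p r := Metric.ball_subset_ball (by linarith [m.r_pos]) hx
  obtain ⟨θ, hθ⟩ := m.exists_active x
  obtain ⟨C, hreach, ⟨-, hCne⟩, d, hd, hdone⟩ := Finset.exists_reflTransGen_terminal
    (step := P.SelectionStep ρ₀ α x)
    (inv := fun C => (C : Set Θ) ⊆ P.active p ∧ C.Nonempty)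
    (done := fun C => ∃ d, P.IsJointGradient x C d ∧ (‖d‖ = 0 ∨ P.SufficientDecrease ρ₀ α x d))
    (fun C ⟨hC, hne⟩ hnd => by
      obtain ⟨d, hd⟩ := P.exists_isJointGradient x hne
      have hcon : ¬ (‖d‖ = 0 ∨ P.SufficientDecrease ρ₀ α x d) := fun h => hnd ⟨d, hd, h⟩
      rw [not_or] at hcon
      obtain ⟨i, hi⟩ := m.exists_active (x - α • d)
      have hstep : ∃ C', P.SelectionStep ρ₀ α x C C' := by
        by_cases hif : i ∈ P.feasible x
        · exact ⟨_, d, hd, hcon.1, hcon.2, i, hi, .inl ⟨hif, rfl⟩⟩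
        · exact ⟨_, d, hd, hcon.1, hcon.2, i, hi, .inr ⟨hif, rfl⟩⟩
      obtain ⟨C', hstep⟩ := hstep
      obtain ⟨h1, h2⟩ := m.selectionStep_ssubset hx hα hαL hαG hC hstep
      exact ⟨C', hstep, ⟨h1, hne.mono h2.subset⟩, h2⟩) {θ}
    ⟨by simpa using m.active_subset x hxr hθ, Finset.singleton_nonempty θ⟩
  have hsel : P.SelectionReturns ρ₀ α x C d := ⟨⟨θ, hθ, hreach⟩, hd, hdone⟩
  obtain ⟨C', hreach', -, z, s, hs, hne'⟩ := Finset.exists_reflTransGen_terminal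
    (step := P.GapStep γ x)
    (inv := fun C => (C : Set Θ) ⊆ P.active p ∧ C.Nonempty)
    (done := fun C => ∃ z s, P.IsRecoverySolution x C z s ∧
      (P.active (x - γ • s) ∩ (C : Set Θ)).Nonempty)
    (fun C ⟨hC, hne⟩ hnd => by
      obtain ⟨z, s, hs⟩ := IsRecoverySolution.exists_of_nonempty P x hne
      have hcon : P.active (x - γ • s) ∩ (C : Set Θ) = ∅ :=
        Set.not_nonempty_iff_eq_empty.1 fun h => hnd ⟨z, s, hs, h⟩
      obtain ⟨i, hi⟩ := m.exists_active (x - γ • s)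
      have hstep : P.GapStep γ x C (insert i C) := ⟨z, s, hs, hcon, i, hi, rfl⟩
      obtain ⟨h1, h2⟩ := m.gapStep_ssubset hx hK hKx hγ hC hstep
      exact ⟨_, hstep, ⟨h1, hne.mono h2.subset⟩, h2⟩) C
    ⟨m.selectionReturns_subset hx hα hαL hαG hsel, hCne⟩
  have hgap : P.GapReturns γ x C (P.gapCandidate γ x s) := ⟨C', hreach', z, s, hs, hne', rfl⟩
  rcases le_or_gt (P.gapCandidate γ x s).2 (P.jointGradientReduction α x d).2 with h | h
  · exact ⟨_, C, d, hsel, _, hgap, .inl ⟨h, rfl⟩⟩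
  · exact ⟨_, C, d, hsel, _, hgap, .inr ⟨h, rfl⟩⟩

/-- The joint gradient step stays near the minimizer and reduces `f`. -/
theorem jointGradientReduction_spec (m : P.LocalModel p L r c μ κ G δ)
    (hx : x ∈ Metric.ball p (r / 2)) (hα : 0 < α) (hαL : L * α ≤ 1 - ρ₀)
    (hαG : α * G ≤ r / 2) {C : Finset Θ} {d : EuclideanSpace ℝ (Fin n)}
    (h : P.SelectionReturns ρ₀ α x C d) :
    (P.jointGradientReduction α x d).1 ∈ Metric.ball p r ∧
      (P.jointGradientReduction α x d).2 = P.f x - P.f (P.jointGradientReduction α x d).1 ∧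
      ρ₀ * α * ‖d‖ ^ 2 ≤ (P.jointGradientReduction α x d).2 := by
  have hxr : x ∈ Metric.ball p r := Metric.ball_subset_ball (by linarith [m.r_pos]) hx
  have hC := m.selectionReturns_subset hx hα hαL hαG h
  obtain ⟨-, hd, hdone⟩ := h
  by_cases hpos : 0 < ‖d‖
  · have hsuf := hdone.resolve_left hpos.ne'
    rw [SufficientDecrease, le_div_iff₀ (by positivity)] at hsuf
    rw [jointGradientReduction, if_pos hpos]
    refine ⟨sub_smul_mem_ball hx hα.le ((mul_le_mul_of_nonneg_left
      (m.norm_le_of_isJointGradient hxr hC hd) hα.le).trans hαG), rfl, ?_⟩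
    simpa [mul_assoc] using hsuf
  · rw [jointGradientReduction, if_neg hpos]
    have hd0 : ‖d‖ = 0 := le_antisymm (not_lt.1 hpos) (norm_nonneg d)
    exact ⟨hxr, by simp, by simp [hd0]⟩

/-- The gap step stays near the minimizer and does not increase `f`; if the current branches
contain a vanishing convex combination of gradients, it contracts the gap up to a quadratic
error. -/
theorem gapReturns_spec [Fintype Θ] (m : P.LocalModel p L r c μ κ G δ)
    (hx : x ∈ Metric.ball p (r / 2)) (hK : K = Fintype.card Θ * L ^ 2 + 1)
    (hKx : K * ‖x - p‖ ≤ r / 2) (hγ : γ ∈ Ioo (0 : ℝ) 1) {C : Finset Θ}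
    (hC : (C : Set Θ) ⊆ P.active p) {out : EuclideanSpace ℝ (Fin n) × ℝ}
    (h : P.GapReturns γ x C out) :
    out.1 ∈ Metric.ball p r ∧ out.2 = P.f x - P.f out.1 ∧ 0 ≤ out.2 ∧
      ∀ w, IsWeight C w → ∑ θ ∈ C, w θ • gradient (P.branch θ) p = 0 →
        γ * (P.f x - P.f p) - (2 * K + 2 * L + L * K + L * K ^ 2) * ‖x - p‖ ^ 2 ≤ out.2 := by
  have hxr : x ∈ Metric.ball p r := Metric.ball_subset_ball (by linarith [m.r_pos]) hx
  obtain ⟨C', hreach, z, s, hs, ⟨θ, hθa, hθC⟩, rfl⟩ := h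
  obtain ⟨hC', hsub⟩ := m.gap_reachable_subset hx hK hKx hγ hC hreach
  have hxs := m.sub_smul_recovery_mem_ball hx hK hKx hγ hC' hs
  have hdec := fun w (hw : IsWeight C w) hw0 =>
    m.f_sub_smul_le hxr hK hγ hsub hC' hs hw hw0 hxs hθC hθa
  by_cases hpos : 0 ≤ P.f x - P.f (x - γ • s)
  · rw [gapCandidate, if_pos hpos]
    refine ⟨hxs, rfl, hpos, fun w hw hw0 => ?_⟩
    have := hdec w hw hw0
    simp only
    linarith
  -- A rejected candidate has negative reduction, so the lower bound holds for `0` as well.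
  · rw [gapCandidate, if_neg hpos]
    refine ⟨hxr, by simp, le_rfl, fun w hw hw0 => ?_⟩
    have := hdec w hw hw0
    simp only
    linarith

/-- The hypotheses `hqγ`, `hqμ` and `hqδ` bound `1 - q` in three regimes: gap step effective, gap of
order `‖x - p‖ ^ 2`, and joint gradient bounded away from zero. -/
theorem step_spec [Fintype Θ] (m : P.LocalModel p L r c μ κ G δ)
    (hρ₀ : 0 < ρ₀) (hα : 0 < α) (hαL : L * α ≤ 1 - ρ₀)
    (hαG : α * G ≤ r / 2) (hK : K = Fintype.card Θ * L ^ 2 + 1) (hγ : γ ∈ Ioo (0 : ℝ) 1)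
    {K₂ r₁ : ℝ} (hK₂ : K₂ = 2 * K + 2 * L + L * K + L * K ^ 2) (hr₁ : 0 < r₁)
    (hr₁r : r₁ ≤ r / 2) (hr₁K : K * r₁ ≤ r / 2) (hr₁κ : κ * (2 * K₂ / γ) * r₁ ≤ μ / 2)
    (hr₁δ : L * r₁ ≤ δ / 2) {q : ℝ} (hqγ : 1 - q ≤ γ / 2)
    (hqμ : (1 - q) * (2 * K₂ / γ) ≤ ρ₀ * α * (μ / 2) ^ 2)
    (hqδ : (1 - q) * (c * r₁ ^ 2) ≤ ρ₀ * α * (δ / 2) ^ 2) (hq : q < 1)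
    (hx : ‖x - p‖ < r₁) (hfx : P.f x - P.f p < c * r₁ ^ 2) {y : EuclideanSpace ℝ (Fin n)}
    (hstep : P.EBIGDStep ρ₀ α γ x y) :
    ‖y - p‖ < r₁ ∧ P.f y - P.f p ≤ q * (P.f x - P.f p) := by
  have hx2 : x ∈ Metric.ball p (r / 2) := mem_ball_iff_norm.2 (hx.trans_le hr₁r)
  have hxr : x ∈ Metric.ball p r := Metric.ball_subset_ball (by linarith [m.r_pos]) hx2
  have hL := m.L_nonneg
  have hκ := m.κ_nonneg
  have hμ := m.μ_pos
  have hδ := m.δ_pos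
  have hK0 : 0 < K := by rw [hK]; positivity
  have hK₂0 : 0 < K₂ := by rw [hK₂]; positivity
  have hKx : K * ‖x - p‖ ≤ r / 2 := (mul_le_mul_of_nonneg_left hx.le hK0.le).trans hr₁K
  have hq1 : 0 < 1 - q := by linarith
  obtain ⟨C, d, hsel, out, hgap, hcase⟩ := hstep
  have hC := m.selectionReturns_subset hx2 hα hαL hαG hsel
  obtain ⟨hJball, hJ, hJred⟩ := m.jointGradientReduction_spec hx2 hα hαL hαG hsel
  obtain ⟨hGball, hG, hG0, hGred⟩ := m.gapReturns_spec hx2 hK hKx hγ hC hgap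
  rw [← hK₂] at hGred
  set F := P.f x - P.f p with hF
  set e := ‖x - p‖ with he
  have he0 : 0 ≤ e := norm_nonneg _
  have hgrow := m.growth x hxr
  have hF0 : 0 ≤ F := (by have := m.c_pos; positivity : 0 ≤ c * e ^ 2).trans hgrow
  have hmain : (1 - q) * F ≤ max (P.jointGradientReduction α x d).2 out.2 := by
    obtain ⟨w, hw, hdw, -⟩ := hsel.2.1
    rcases m.dichotomy C with ⟨v, hv, hv0⟩ | hbig
    · by_cases hcmp : K₂ * e ^ 2 ≤ γ / 2 * F
      · refine le_max_of_le_right ((mul_le_mul_of_nonneg_right hqγ hF0).trans ?_)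
        have := hGred v hv hv0
        linarith
      · refine le_max_of_le_left (le_trans ?_ hJred)
        have hT : F ≤ 2 * K₂ / γ * e ^ 2 := by
          rw [div_mul_eq_mul_div, le_div_iff₀ hγ.1]
          linarith
        have hT0 : 0 ≤ 2 * K₂ / γ := div_nonneg (by linarith) hγ.1.le
        have h1 := m.dual x hxr C hC w hw
        rw [← hdw, ← he, ← hF] at h1
        -- Here `F` is quadratic in `e`, so for small `r₁` the correction in `dual` takes at most
        -- half of `μ * e`.
        have h2 : κ * F ≤ μ / 2 * e :=
          calc κ * F ≤ κ * (2 * K₂ / γ * e ^ 2) := by gcongr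
            _ = κ * (2 * K₂ / γ) * e * e := by ring
            _ ≤ κ * (2 * K₂ / γ) * r₁ * e := by gcongr
            _ ≤ _ := by gcongr
        have h3 : μ / 2 * e ≤ ‖d‖ := by linarith
        calc (1 - q) * F ≤ (1 - q) * (2 * K₂ / γ * e ^ 2) := by gcongr
          _ = (1 - q) * (2 * K₂ / γ) * e ^ 2 := by ring
          _ ≤ ρ₀ * α * (μ / 2) ^ 2 * e ^ 2 := by gcongr
          _ = ρ₀ * α * (μ / 2 * e) ^ 2 := by ring
          _ ≤ _ := by gcongr
    · refine le_max_of_le_left (le_trans ?_ hJred)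
      have h1 : ‖∑ θ ∈ C, w θ • (gradient (P.branch θ) p - gradient (P.branch θ) x)‖ ≤ L * e :=
        hw.norm_sum_le fun θ hθ => by
          rw [norm_sub_rev]
          exact m.norm_gradient_sub_le x hxr θ (hC hθ)
      simp only [smul_sub, Finset.sum_sub_distrib, ← hdw] at h1
      have h2 := hbig w hw
      have h3 := norm_le_norm_add_norm_sub' (∑ θ ∈ C, w θ • gradient (P.branch θ) p) d
      have h4 : L * e ≤ δ / 2 := (mul_le_mul_of_nonneg_left hx.le hL).trans hr₁δ
      have h5 : δ / 2 ≤ ‖d‖ := by linarith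
      calc (1 - q) * F ≤ (1 - q) * (c * r₁ ^ 2) := by gcongr
        _ ≤ ρ₀ * α * (δ / 2) ^ 2 := hqδ
        _ ≤ _ := by gcongr
  have hy : y ∈ Metric.ball p r ∧ P.f y - P.f p ≤ q * F := by
    rcases hcase with ⟨hle, rfl⟩ | ⟨hlt, rfl⟩
    · rw [max_eq_left hle, hJ] at hmain
      exact ⟨hJball, by linarith⟩
    · rw [max_eq_right hlt.le, hG] at hmain
      exact ⟨hGball, by linarith⟩
  refine ⟨?_, hy.2⟩
  have h1 := m.growth y hy.1
  have h2 : q * F ≤ F := mul_le_of_le_one_left hF0 hq.le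
  -- The candidates are only known to lie in the ball of radius `r`; the level bound with quadratic
  -- growth brings `y` back within `r₁`.
  have h3 : c * ‖y - p‖ ^ 2 < c * r₁ ^ 2 := by linarith [hy.2]
  exact lt_of_pow_lt_pow_left₀ 2 hr₁.le (lt_of_mul_lt_mul_left h3 m.c_pos.le)

end Steps

end LocalModel

end BranchedFunction
-- Choice of constants and convergence.
namespace BranchedFunction

/-- The added `1` keeps thresholds meaningful when a coefficient such as `L` or `G` vanishes. -/
theorem mul_le_of_le_div_add_one {a b t : ℝ} (ha : 0 ≤ a) (ht : 0 ≤ t) (h : t ≤ b / (a + 1)) :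
    a * t ≤ b := by
  rw [le_div_iff₀ (by positivity)] at h
  linarith

/-- One iteration started near the minimizer is well defined, stays near it and contracts the
gap. -/
theorem LocalModel.exists_contraction {n : ℕ} {Θ : Type*} [Fintype Θ] [DecidableEq Θ]
    {P : BranchedFunction n Θ} {p : EuclideanSpace ℝ (Fin n)} {L r c μ κ G δ : ℝ}
    (m : P.LocalModel p L r c μ κ G δ) {ρ₀ γ : ℝ} (hρ₀ : ρ₀ ∈ Ioo (0 : ℝ) 1)
    (hγ : γ ∈ Ioo (0 : ℝ) 1) :
    ∃ α₀ > (0 : ℝ), ∃ r₁ > (0 : ℝ), (∀ x, ‖x - p‖ < r₁ → c * ‖x - p‖ ^ 2 ≤ P.f x - P.f p) ∧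
      ∀ α ∈ Ioo (0 : ℝ) α₀, ∃ q ∈ Ioo (0 : ℝ) 1,
        ∀ x, ‖x - p‖ < r₁ → P.f x - P.f p < c * r₁ ^ 2 →
          P.EBIGDWellDefinedAt ρ₀ α γ x ∧ (∃ y, P.EBIGDStep ρ₀ α γ x y) ∧
          ∀ y, P.EBIGDStep ρ₀ α γ x y → ‖y - p‖ < r₁ ∧ P.f y - P.f p ≤ q * (P.f x - P.f p) := by
  have hL := m.L_nonneg
  have hr := m.r_pos
  have hc := m.c_pos
  have hμ := m.μ_pos
  have hκ := m.κ_nonneg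
  have hG := m.G_nonneg
  have hδ := m.δ_pos
  obtain ⟨hρ0, hρ1⟩ := hρ₀
  have hγ0 := hγ.1
  have hρ' : 0 < 1 - ρ₀ := sub_pos.2 hρ1
  obtain ⟨K, hK⟩ : ∃ K, K = Fintype.card Θ * L ^ 2 + 1 := ⟨_, rfl⟩
  have hK0 : 0 < K := by rw [hK]; positivity
  obtain ⟨K₂, hK₂⟩ : ∃ K₂, K₂ = 2 * K + 2 * L + L * K + L * K ^ 2 := ⟨_, rfl⟩
  have hK₂0 : 0 < K₂ := by rw [hK₂]; positivity
  set T := 2 * K₂ / γ with hT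
  have hT0 : 0 < T := by positivity
  set r₁ := min (min (r / 2) (r / 2 / (K + 1)))
    (min (μ / 2 / (κ * T + 1)) (δ / 2 / (L + 1))) with hr₁
  have hr₁0 : 0 < r₁ := by positivity
  have hr₁r : r₁ ≤ r / 2 := (min_le_left _ _).trans (min_le_left _ _)
  have hr₁K : K * r₁ ≤ r / 2 :=
    mul_le_of_le_div_add_one hK0.le hr₁0.le ((min_le_left _ _).trans (min_le_right _ _))
  have hr₁κ : κ * T * r₁ ≤ μ / 2 :=
    mul_le_of_le_div_add_one (by positivity) hr₁0.le ((min_le_right _ _).trans (min_le_left _ _))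
  have hr₁δ : L * r₁ ≤ δ / 2 :=
    mul_le_of_le_div_add_one hL hr₁0.le ((min_le_right _ _).trans (min_le_right _ _))
  refine ⟨min ((1 - ρ₀) / (L + 1)) (r / 2 / (G + 1)), by positivity, r₁, hr₁0,
    fun x hx => m.growth x (mem_ball_iff_norm.2 (by linarith)), fun α hα => ?_⟩
  obtain ⟨hα0, hα1⟩ := hα
  have hαL : L * α ≤ 1 - ρ₀ :=
    mul_le_of_le_div_add_one hL hα0.le (hα1.le.trans (min_le_left _ _))
  have hαG : α * G ≤ r / 2 := by
    rw [mul_comm]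
    exact mul_le_of_le_div_add_one hG hα0.le (hα1.le.trans (min_le_right _ _))
  -- The guaranteed relative gain, one term per regime of `step_spec`; it depends on `α`, while `r₁`
  -- does not.
  obtain ⟨η, hη⟩ : ∃ η, η = min (γ / 2)
    (min (ρ₀ * α * (μ / 2) ^ 2 / T) (ρ₀ * α * (δ / 2) ^ 2 / (c * r₁ ^ 2))) := ⟨_, rfl⟩
  have hη0 : 0 < η := by rw [hη]; positivity
  have hηγ : η ≤ γ / 2 := hη ▸ min_le_left _ _
  have hημ : η * T ≤ ρ₀ * α * (μ / 2) ^ 2 :=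
    (le_div_iff₀ hT0).1 (hη ▸ (min_le_right _ _).trans (min_le_left _ _))
  have hηδ : η * (c * r₁ ^ 2) ≤ ρ₀ * α * (δ / 2) ^ 2 :=
    (le_div_iff₀ (by positivity)).1 (hη ▸ (min_le_right _ _).trans (min_le_right _ _))
  refine ⟨1 - η, ⟨by linarith [hγ.2], by linarith⟩, fun x hx hfx => ?_⟩
  have hx2 : x ∈ Metric.ball p (r / 2) := mem_ball_iff_norm.2 (hx.trans_le hr₁r)
  have hKx : K * ‖x - p‖ ≤ r / 2 := (mul_le_mul_of_nonneg_left hx.le hK0.le).trans hr₁K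
  refine ⟨m.wellDefinedAt hx2 hα0 hαL hαG hK hKx hγ, m.exists_step hx2 hα0 hαL hαG hK hKx hγ,
    fun y hy => m.step_spec hρ0 hα0 hαL hαG hK hγ hK₂ hr₁0 hr₁r hr₁K hr₁κ hr₁δ
      (by rwa [sub_sub_cancel]) (by rwa [sub_sub_cancel]) (by rwa [sub_sub_cancel])
      (by linarith) hx hfx hy⟩

end BranchedFunction

theorem mainTheorem2 {n : ℕ} {Θ : Type*} [Fintype Θ] [DecidableEq Θ]
    (P : BranchedFunction n Θ) (hP : P.IsPiecewiseDifferentiable)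
    (L : NNReal) (hL : ∀ θ, LipschitzOnWith L (gradient (P.branch θ)) (P.dom θ))
    (h2 : P.TwiceDifferentiable)
    (xs : EuclideanSpace ℝ (Fin n)) (hmin : IsLocalMin P.f xs)
    (hmax : P.LocallyMaxRepresentable xs)
    (hcpd : P.ComplementaryPosDef xs) (hdim : P.DimensionConsistent xs)
    (ρ₀ γ : ℝ) (hρ₀ : ρ₀ ∈ Set.Ioo (0 : ℝ) 1) (hγ : γ ∈ Set.Ioo (0 : ℝ) 1) :
    ∃ α₀ > (0 : ℝ), ∃ U ∈ 𝓝 xs, ∀ α ∈ Set.Ioo (0 : ℝ) α₀,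
      ∃ q ∈ Set.Ioo (0 : ℝ) 1, ∃ K : ℝ, ∀ x₀ ∈ U,
        (∀ x, Relation.ReflTransGen (P.EBIGDStep ρ₀ α γ) x₀ x →
          P.EBIGDWellDefinedAt ρ₀ α γ x ∧ ∃ y, P.EBIGDStep ρ₀ α γ x y) ∧
        ∀ X : ℕ → EuclideanSpace ℝ (Fin n), X 0 = x₀ →
          (∀ k, P.EBIGDStep ρ₀ α γ (X k) (X (k + 1))) →
          ∀ k, P.f xs ≤ P.f (X k) ∧
            P.f (X (k + 1)) - P.f xs ≤ q * (P.f (X k) - P.f xs) ∧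
            ‖X k - xs‖ ≤ K * q ^ k := by
  obtain ⟨r, c, μ, κ, G, δ, m⟩ :=
    BranchedFunction.exists_localModel hP hL h2 hmax hcpd hdim
  obtain ⟨α₀, hα₀, r₁, hr₁, hgrow, hstep⟩ := m.exists_contraction hρ₀ hγ
  have hc := m.c_pos
  -- The level condition makes this neighbourhood invariant under iterations.
  refine ⟨α₀, hα₀, {x | ‖x - xs‖ < r₁ ∧ P.f x - P.f xs < c * r₁ ^ 2}, ?_, fun α hα => ?_⟩
  · have h1 : ∀ᶠ x in 𝓝 xs, ‖x - xs‖ < r₁ := by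
      filter_upwards [Metric.ball_mem_nhds xs hr₁] with x hx using mem_ball_iff_norm.1 hx
    have h2 : ∀ᶠ x in 𝓝 xs, P.f x - P.f xs < c * r₁ ^ 2 :=
      (hP.continuous.sub continuous_const).continuousAt.eventually_lt continuousAt_const
        (by
          change P.f xs - P.f xs < c * r₁ ^ 2
          rw [sub_self]
          positivity)
    exact h1.and h2
  obtain ⟨q, ⟨hq0, hq1⟩, hq⟩ := hstep α hα
  have hnonneg : ∀ x, ‖x - xs‖ < r₁ → 0 ≤ P.f x - P.f xs := fun x hx =>
    (by positivity : 0 ≤ c * ‖x - xs‖ ^ 2).trans (hgrow x hx)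
  have hinv : ∀ x y, (‖x - xs‖ < r₁ ∧ P.f x - P.f xs < c * r₁ ^ 2) → P.EBIGDStep ρ₀ α γ x y →
      ‖y - xs‖ < r₁ ∧ P.f y - P.f xs < c * r₁ ^ 2 := fun x y hx hxy => by
    obtain ⟨h1, h2⟩ := (hq x hx.1 hx.2).2.2 y hxy
    have h3 := mul_le_of_le_one_left (hnonneg x hx.1) hq1.le
    exact ⟨h1, by linarith [hx.2]⟩
  -- Quadratic growth bounds the squared distance by `r₁ ^ 2 * q ^ k`, so distances decay at rate
  -- `√q`; the gap contracts by `q`, which is at most `√q`.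
  refine ⟨√q, ⟨Real.sqrt_pos.2 hq0, (Real.sqrt_lt' one_pos).2 (by simpa using hq1)⟩, r₁,
    fun x₀ hx₀ => ⟨fun x hreach => ?_, fun X hX0 hX k => ?_⟩⟩
  · have hx : ‖x - xs‖ < r₁ ∧ P.f x - P.f xs < c * r₁ ^ 2 := by
      induction hreach with
      | refl => exact hx₀
      | tail _ h ih => exact hinv _ _ ih h
    exact ⟨(hq x hx.1 hx.2).1, (hq x hx.1 hx.2).2.1⟩
  · have hmem : ∀ k, ‖X k - xs‖ < r₁ ∧ P.f (X k) - P.f xs < c * r₁ ^ 2 := fun k => by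
      induction k with
      | zero => rw [hX0]; exact hx₀
      | succ k ih => exact hinv _ _ ih (hX k)
    have hcontr : ∀ k, P.f (X (k + 1)) - P.f xs ≤ q * (P.f (X k) - P.f xs) := fun k =>
      ((hq _ (hmem k).1 (hmem k).2).2.2 _ (hX k)).2
    have hrate : ∀ k, P.f (X k) - P.f xs ≤ q ^ k * (c * r₁ ^ 2) := fun k => by
      induction k with
      | zero => simpa using (hmem 0).2.le
      | succ k ih =>
        calc _ ≤ q * (P.f (X k) - P.f xs) := hcontr k
          _ ≤ q * (q ^ k * (c * r₁ ^ 2)) := by gcongr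
          _ = _ := by ring
    have hk := hnonneg _ (hmem k).1
    refine ⟨by linarith, (hcontr k).trans ?_, ?_⟩
    · gcongr
      exact Real.le_sqrt_of_sq_le (by nlinarith)
    · refine le_of_pow_le_pow_left₀ two_ne_zero (by positivity) ?_
      refine le_of_mul_le_mul_left ((hgrow _ (hmem k).1).trans ((hrate k).trans_eq ?_)) hc
      rw [mul_pow, ← pow_mul, mul_comm k 2, pow_mul, Real.sq_sqrt hq0.le]
      ring
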